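/- For a real polynomial $p$ and $\varkappa\in\mathbb R$ let $F_\varkappa[p]=p\,p''-\varkappa\,(p')^2$, and let $Z_C(f)$ denote the number of non-real zeroes of a real polynomial $f$, counted with multiplicities. Let $3\le d\le n$ be integers and consider real polynomials $p$ of degree $n$ with only real zeroes and exactly $d$ distinct zeroes, i.e. $$p(z)=a_0\prod_{k=1}^{d}(z-\lambda_k)^{n_k},\qquad a_0\in\mathbb R\setminus\{0\},\quad \lambda_1<\lambda_2<\dots<\lambda_d,\quad n_k\ge 1,\quad n_1+\dots+n_d=n,$$ and put $m_1=m_1(p)=\min\{n_2,\dots,n_{d-1}\}$. 1. If $k\in\{2,\dots,d-1\}$ and $$\frac{n-d+k-1}{n-d+k}\le\varkappa<\frac{n-d+k}{n-d+k+1},$$ then $Z_C(F_\varkappa[p])\ge 2k-2$ for every such $p$. 2. If $0<\varkappa<\dfrac{n-d+1}{n-d+2}$, then $F_\varkappa[p]$ can have only real zeroes: there is such a $p$ (of the same degree $n$ and with the same number $d$ of distinct zeroes) with $\dfrac{m_1-1}{m_1}<\varkappa$ and $Z_C(F_\varkappa[p])=0$. Thus no positive lower bound for $Z_C(F_\varkappa[p])$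 in terms of $n$, $d$ and $\varkappa$ holds in this range. -/

import Mathlib

open Polynomial

noncomputable section

/-- The differential polynomial `F_κ[p] = p p'' - κ (p')²`. -/
def diffPoly (κ : ℝ) (p : ℝ[X]) : ℝ[X] :=
  p * derivative (derivative p) - C κ * derivative p ^ 2

/-- `Z_C(f)`: the number of non-real complex zeroes of a real polynomial `f`,
counted with multiplicities. -/
def nonrealZeroCount (f : ℝ[X]) : ℕ :=
  Multiset.card ((f.map (algebraMap ℝ ℂ)).roots.filter fun z => z.im ≠ 0)

/-- `p = a ∏ (X - lam k) ^ mult k` with `a ≠ 0`, where the `lam k` are real, listed in strictly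
increasing order, and the multiplicities are positive: `p` is a real polynomial with only real
zeroes, and its distinct zeroes are exactly the `d` numbers `lam k`, with multiplicities
`mult k`. -/
structure HasRealZeroes {d : ℕ} (p : ℝ[X]) (lam : Fin d → ℝ) (mult : Fin d → ℕ) : Prop where
  strictMono : StrictMono lam
  mult_pos : ∀ k, 0 < mult k
  exists_eq : ∃ a : ℝ, a ≠ 0 ∧ p = C a * ∏ k, (X - C (lam k)) ^ mult k

/-- `m₁`: the least multiplicity among the zeroes other than the smallest and the largest one
(for `3 ≤ d` there are such zeroes). -/
def minInteriorMult {d : ℕ} (mult : Fin d → ℕ) : ℕ :=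
  sInf (mult '' {k : Fin d | 0 < (k : ℕ) ∧ (k : ℕ) + 1 < d})

end

/-! Let q = p'/p = ∑ n_i/(x - λ_i) and α = 1 - κ. Then F_κ[p] = p²(q' + αq²), so up to real linear
factors F_κ[p] is `reducedDiffPoly`, of degree 2(d - 1) when αn ≠ 1. The lower bound therefore
amounts to at most 2(d - k) real roots of q' + αq², with multiplicity
(`card_roots_reducedDiffPoly_le`).

Two facts give this. First, q' + αq² = 0 says (1/q)' = α. Expanding 1/q in partial fractions at the
zeroes μ of q turns this into ∑ c_μ/(x - μ)² = const with c_μ > 0. The left side is convex between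
consecutive μ and strictly monotone outside them, so each inner component holds at most two roots
and each outer one at most one. Second, any k multiplicities sum to at most n - d + k ≤ 1/α, so by
Cauchy–Schwarz the part of q from any k nodes is smaller in absolute value than q at a root
(`sq_sum_lt_sq_sum`). Hence a root with q > 0 has more than k nodes on its left, one with q < 0 more
than k on its right. Labelling a root by the number of nodes on its left, minus k if q > 0, leaves
labels 0, …, d - k, and roots with equal labels share a component. The extreme labels occur only in
the outer components, so there are at most 1 + 1 + 2(d - k - 1) roots.

For the second claim put all excess multiplicity at the smallest zero and add simple zeroes one at a
time, each far to the right. F_κ is negative at simple zeroes and stays positive at chosen points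
around them; these sign changes exhaust the degree left after removing the multiple zero. -/

/-! ### Non-real zeroes as degree minus real roots -/

lemma filter_im_eq_zero_roots_map (f : ℝ[X]) :
    ((f.map (algebraMap ℝ ℂ)).roots.filter fun z => ¬ z.im ≠ 0) =
      f.roots.map (algebraMap ℝ ℂ) := by
  have hinj : Function.Injective (algebraMap ℝ ℂ) := (algebraMap ℝ ℂ).injective
  ext z
  by_cases hz : z.im = 0
  · obtain ⟨x, rfl⟩ : ∃ x : ℝ, algebraMap ℝ ℂ x = z := ⟨z.re, Complex.ext (by simp) (by simp [hz])⟩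
    rw [Multiset.count_filter_of_pos (by simp), Multiset.count_map_eq_count' _ _ hinj,
      count_roots, count_roots, ← eq_rootMultiplicity_map hinj]
  · rw [Multiset.count_filter_of_neg (by simpa using hz), eq_comm, Multiset.count_eq_zero]
    rintro h
    obtain ⟨x, -, rfl⟩ := Multiset.mem_map.1 h
    simp at hz

lemma nonrealZeroCount_add_card_roots (f : ℝ[X]) :
    nonrealZeroCount f + f.roots.card = f.natDegree := by
  have h := congrArg Multiset.card (Multiset.filter_add_not (fun z : ℂ => z.im ≠ 0)
    (f.map (algebraMap ℝ ℂ)).roots)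
  rw [Multiset.card_add, filter_im_eq_zero_roots_map, Multiset.card_map,
    ← (IsAlgClosed.splits (f.map (algebraMap ℝ ℂ))).natDegree_eq_card_roots, natDegree_map] at h
  exact h

lemma nonrealZeroCount_mul {f g : ℝ[X]} (hf : f ≠ 0) (hg : g ≠ 0) :
    nonrealZeroCount (f * g) = nonrealZeroCount f + nonrealZeroCount g := by
  have h1 := nonrealZeroCount_add_card_roots f
  have h2 := nonrealZeroCount_add_card_roots g
  have h3 := nonrealZeroCount_add_card_roots (f * g)
  rw [roots_mul (mul_ne_zero hf hg), Multiset.card_add, natDegree_mul hf hg] at h3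
  omega

lemma natDegree_diffPoly_le (κ : ℝ) (p : ℝ[X]) :
    (diffPoly κ p).natDegree ≤ 2 * p.natDegree - 2 := by
  have h1 := natDegree_derivative_le p
  have h2 := natDegree_derivative_le (derivative p)
  unfold diffPoly
  by_cases h0 : p.natDegree = 0
  · rw [derivative_of_natDegree_zero h0]; simp
  by_cases h1' : p.natDegree = 1
  · have : derivative (derivative p) = 0 := derivative_of_natDegree_zero (by omega)
    rw [this, mul_zero, zero_sub, natDegree_neg]
    refine (natDegree_C_mul_le _ _).trans (natDegree_pow_le.trans (by omega))
  refine (natDegree_sub_le _ _).trans (max_le ?_ ?_)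
  · exact natDegree_mul_le.trans (by omega)
  · exact (natDegree_C_mul_le _ _).trans (natDegree_pow_le.trans (by omega))

/-! ### Divided differences of 1/(x - μ)²: convexity with multiplicities -/

section Residues

variable (S : Finset ℝ)

/-- The Wronskian of a product of linear factors and the product with one factor left out. -/
lemma derivative_prod_mul_sub {ι : Type*} [DecidableEq ι] (s : Finset ι) (a : ι → ℝ) {i : ι}
    (hi : i ∈ s) :
    derivative (∏ j ∈ s, (X - C (a j))) * ∏ j ∈ s.erase i, (X - C (a j)) -
      (∏ j ∈ s, (X - C (a j))) * derivative (∏ j ∈ s.erase i, (X - C (a j))) =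
      (∏ j ∈ s.erase i, (X - C (a j))) ^ 2 := by
  rw [← Finset.mul_prod_erase s _ hi, derivative_mul]
  simp
  ring

/-- If `s` divides `B ∏ (X - μ)² - ∑ c μ ∏_{ν ≠ μ} (X - ν)²` and `r μ` is an inverse of `(X - μ)²`
modulo `s`, then `B = ∑ c μ r μ` modulo `s`; this compares the coefficients of degree `N`. -/
lemma sum_coeff_eq_zero_of_dvd {s : ℝ[X]} {N : ℕ} (hN : 1 ≤ N)
    (hsN : s.natDegree = N + 1) (B : ℝ) (c : ℝ → ℝ) (r : ℝ → ℝ[X])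
    (hr : ∀ μ ∈ S, (r μ).natDegree ≤ N) (hinv : ∀ μ ∈ S, s ∣ (X - C μ) ^ 2 * r μ - 1)
    (hdvd : s ∣ C B * (∏ μ ∈ S, (X - C μ)) ^ 2 -
      ∑ μ ∈ S, C (c μ) * (∏ ν ∈ S.erase μ, (X - C ν)) ^ 2) :
    ∑ μ ∈ S, c μ * (r μ).coeff N = 0 := by
  classical
  have hcop : IsCoprime s ((∏ μ ∈ S, (X - C μ)) ^ 2) := by
    refine IsCoprime.pow_right (IsCoprime.prod_right fun μ hμ => ?_)
    obtain ⟨t, ht⟩ := hinv μ hμ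
    exact ⟨-t, (X - C μ) * r μ, by linear_combination ht⟩
  have hD : s ∣ C B - ∑ μ ∈ S, C (c μ) * r μ := by
    refine hcop.dvd_of_dvd_mul_left ?_
    have : (∏ μ ∈ S, (X - C μ)) ^ 2 * (C B - ∑ μ ∈ S, C (c μ) * r μ) =
        (C B * (∏ μ ∈ S, (X - C μ)) ^ 2 -
          ∑ μ ∈ S, C (c μ) * (∏ ν ∈ S.erase μ, (X - C ν)) ^ 2) -
        ∑ μ ∈ S, C (c μ) * (∏ ν ∈ S.erase μ, (X - C ν)) ^ 2 * ((X - C μ) ^ 2 * r μ - 1) := by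
      rw [sub_sub, ← Finset.sum_add_distrib, mul_sub, Finset.mul_sum, mul_comm]
      congr 1
      refine Finset.sum_congr rfl fun μ hμ => ?_
      rw [← Finset.mul_prod_erase S _ hμ]
      ring
    rw [this]
    exact dvd_sub hdvd (Finset.dvd_sum fun μ hμ => (hinv μ hμ).mul_left _)
  have hdeg : (C B - ∑ μ ∈ S, C (c μ) * r μ).natDegree ≤ N := by
    refine (natDegree_sub_le _ _).trans (max_le (by simp) ?_)
    exact natDegree_sum_le_of_forall_le _ _ fun μ hμ => (natDegree_C_mul_le _ _).trans (hr μ hμ)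
  -- The degree is at most N, while s has degree N + 1.
  have h0 : C B - ∑ μ ∈ S, C (c μ) * r μ = 0 := by
    by_contra h
    have := natDegree_le_of_dvd hD h
    omega
  have hN0 : N ≠ 0 := by omega
  have := congrArg (coeff · N) h0
  simpa [finsetSum_coeff, coeff_C, hN0] using this

/-- Three roots of `B ∏ (X - μ)² - ∑ c μ ∏_{ν ≠ μ} (X - ν)²` cannot lie in one component of the
complement of the set of all `μ`. -/
lemma not_cubic_dvd (hS : S.Nonempty) (B : ℝ) (c : ℝ → ℝ) (hc : ∀ μ ∈ S, 0 < c μ) (x y z : ℝ)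
    (hxy : ∀ μ ∈ S, 0 < (x - μ) * (y - μ)) (hyz : ∀ μ ∈ S, 0 < (y - μ) * (z - μ))
    (hxz : ∀ μ ∈ S, 0 < (x - μ) * (z - μ)) :
    ¬ (X - C x) * ((X - C y) * (X - C z)) ∣ C B * (∏ μ ∈ S, (X - C μ)) ^ 2 -
      ∑ μ ∈ S, C (c μ) * (∏ ν ∈ S.erase μ, (X - C ν)) ^ 2 := by
  intro hdvd
  -- With t = X - μ the cubic is t³ - et² + ft - 1/v, so modulo it 1/t = v(t² - et + f); multiplying
  -- by 1/t once more gives r. Its leading coefficient u is the second divided difference of 1/(X -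
  -- μ)² at x, y, z, positive because f > 0. Divisibility instead of distinct roots covers
  -- coincident x, y, z.
  let v : ℝ → ℝ := fun μ => ((x - μ) * (y - μ) * (z - μ))⁻¹
  let e : ℝ → ℝ := fun μ => (x - μ) + (y - μ) + (z - μ)
  let f : ℝ → ℝ := fun μ => (x - μ) * (y - μ) + (y - μ) * (z - μ) + (x - μ) * (z - μ)
  let u : ℝ → ℝ := fun μ => f μ * v μ ^ 2
  let r : ℝ → ℝ[X] := fun μ => C (u μ) * X ^ 2 + C (v μ - e μ * u μ - 2 * μ * u μ) * X +
    C (u μ * μ ^ 2 - (v μ - e μ * u μ) * μ + (f μ * u μ - e μ * v μ))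
  have hv0 : ∀ μ ∈ S, (x - μ) * (y - μ) * (z - μ) ≠ 0 := fun μ hμ =>
    mul_ne_zero (hxy μ hμ).ne' (right_ne_zero_of_mul (hyz μ hμ).ne')
  have hinv : ∀ μ ∈ S, (X - C x) * ((X - C y) * (X - C z)) ∣ (X - C μ) ^ 2 * r μ - 1 := by
    intro μ hμ
    refine ⟨C (u μ) * (X - C μ) + C (v μ), ?_⟩
    have h := congrArg C (mul_inv_cancel₀ (hv0 μ hμ))
    change C ((x - μ) * (y - μ) * (z - μ) * v μ) = C 1 at h
    simp only [map_mul, map_sub, map_one] at h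
    simp only [r, u, e, f, map_mul, map_sub, map_add, map_pow, C_ofNat]
    linear_combination (1 + ((C x - C μ) * (C y - C μ) + (C y - C μ) * (C z - C μ) +
      (C x - C μ) * (C z - C μ)) * C (v μ) * (X - C μ)) * h
  have hsum := sum_coeff_eq_zero_of_dvd S (N := 2) one_le_two
    (by rw [(monic_X_sub_C x).natDegree_mul ((monic_X_sub_C y).mul (monic_X_sub_C z)),
      (monic_X_sub_C y).natDegree_mul (monic_X_sub_C z)]; simp)
    B c r (fun μ _ => natDegree_quadratic_le) hinv hdvd
  refine (Finset.sum_pos (fun μ hμ => ?_) hS).ne' hsum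
  have hcoeff : (r μ).coeff 2 = u μ := by
    have : ∀ a b c : ℝ, (C a * X ^ 2 + C b * X + C c).coeff 2 = a := by simp
    exact this _ _ _
  rw [hcoeff]
  have h1 := hxy μ hμ
  have h2 := hyz μ hμ
  have h3 := hxz μ hμ
  have h4 : v μ ≠ 0 := inv_ne_zero (hv0 μ hμ)
  have h5 := hc μ hμ
  simp only [u, f]
  positivity

/-- Two roots of `B ∏ (X - μ)² - ∑ c μ ∏_{ν ≠ μ} (X - ν)²` cannot lie both to the left, or both to
the right, of all `μ`. -/
lemma not_quadratic_dvd (hS : S.Nonempty) (B : ℝ) (c : ℝ → ℝ) (hc : ∀ μ ∈ S, 0 < c μ) (x y : ℝ)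
    (ε : ℝ) (hx : ∀ μ ∈ S, 0 < ε * (x - μ)) (hy : ∀ μ ∈ S, 0 < ε * (y - μ)) :
    ¬ (X - C x) * (X - C y) ∣ C B * (∏ μ ∈ S, (X - C μ)) ^ 2 -
      ∑ μ ∈ S, C (c μ) * (∏ ν ∈ S.erase μ, (X - C ν)) ^ 2 := by
  intro hdvd
  -- Same computation with t² - et + 1/v; here u is the first divided difference, whose sign is that
  -- of -ε.
  let v : ℝ → ℝ := fun μ => ((x - μ) * (y - μ))⁻¹
  let e : ℝ → ℝ := fun μ => (x - μ) + (y - μ)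
  let u : ℝ → ℝ := fun μ => -e μ * v μ ^ 2
  let r : ℝ → ℝ[X] := fun μ => C (u μ) * X + C (-v μ - e μ * u μ - u μ * μ)
  have hv0 : ∀ μ ∈ S, (x - μ) * (y - μ) ≠ 0 := fun μ hμ =>
    mul_ne_zero (right_ne_zero_of_mul (hx μ hμ).ne') (right_ne_zero_of_mul (hy μ hμ).ne')
  have hinv : ∀ μ ∈ S, (X - C x) * (X - C y) ∣ (X - C μ) ^ 2 * r μ - 1 := by
    intro μ hμ
    refine ⟨C (u μ) * (X - C μ) - C (v μ), ?_⟩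
    have h := congrArg C (mul_inv_cancel₀ (hv0 μ hμ))
    change C ((x - μ) * (y - μ) * v μ) = C 1 at h
    simp only [map_mul, map_sub, map_one] at h
    simp only [r, u, e, map_mul, map_sub, map_add, map_pow, map_neg]
    linear_combination (1 + ((C x - C μ) + (C y - C μ)) * C (v μ) * (X - C μ)) * h
  have hsum := sum_coeff_eq_zero_of_dvd S (N := 1) le_rfl
    (by rw [(monic_X_sub_C x).natDegree_mul (monic_X_sub_C y)]; simp)
    B c r (fun μ _ => natDegree_linear_le) hinv hdvd
  have hneg : ∑ μ ∈ S, ε * (c μ * (r μ).coeff 1) = 0 := by rw [← Finset.mul_sum, hsum, mul_zero]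
  refine (Finset.sum_neg (fun μ hμ => ?_) hS).ne hneg
  have hcoeff : (r μ).coeff 1 = u μ := by simp [r, coeff_C]
  rw [hcoeff]
  have h1 := hx μ hμ
  have h2 := hy μ hμ
  have h4 : 0 < v μ ^ 2 := by
    have := inv_ne_zero (hv0 μ hμ)
    positivity
  have h5 := hc μ hμ
  have : 0 < c μ * v μ ^ 2 * (ε * (x - μ) + ε * (y - μ)) := by positivity
  simp only [u, e]
  linarith

end Residues

/-! ### Clearing denominators in q and q' + αq² -/

/-- The product of the linear factors belonging to the nodes `lam`. -/
noncomputable def nodePoly {d : ℕ} (lam : Fin d → ℝ) : ℝ[X] := ∏ i, (X - C (lam i))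

/-- The product of all the linear factors but the one belonging to `lam i`. -/
noncomputable def nodePolyErase {d : ℕ} (lam : Fin d → ℝ) (i : Fin d) : ℝ[X] :=
  ∏ j ∈ Finset.univ.erase i, (X - C (lam j))

/-- The numerator of `∑ w i / (X - lam i)`. -/
noncomputable def logDerivNum {d : ℕ} (lam w : Fin d → ℝ) : ℝ[X] :=
  ∑ i, C (w i) * nodePolyErase lam i

/-- The numerator of `q' + α q²`, where `q = ∑ w i / (X - lam i)`. -/
noncomputable def reducedDiffPoly {d : ℕ} (α : ℝ) (lam w : Fin d → ℝ) : ℝ[X] :=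
  C α * logDerivNum lam w ^ 2 - ∑ i, C (w i) * nodePolyErase lam i ^ 2

section Nodes

variable {d : ℕ} (lam w : Fin d → ℝ)

lemma X_sub_C_mul_nodePolyErase (i : Fin d) :
    (X - C (lam i)) * nodePolyErase lam i = nodePoly lam :=
  Finset.mul_prod_erase Finset.univ (fun j => X - C (lam j)) (Finset.mem_univ i)

/-- With L the node polynomial and V the numerator of q, both sides are -L²q'. The left side is also
V²(L/V)', which links q' to the derivative of 1/q. -/
lemma nodePoly_wronskian :
    derivative (nodePoly lam) * logDerivNum lam w - nodePoly lam * derivative (logDerivNum lam w) =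
      ∑ i, C (w i) * nodePolyErase lam i ^ 2 := by
  simp only [logDerivNum, derivative_sum, Finset.mul_sum, ← Finset.sum_sub_distrib, derivative_C_mul]
  refine Finset.sum_congr rfl fun i _ => ?_
  have := derivative_prod_mul_sub Finset.univ lam (Finset.mem_univ i)
  simp only [nodePolyErase, ← this, nodePoly]
  ring

lemma monic_nodePoly : (nodePoly lam).Monic := monic_prod_of_monic _ _ fun _ _ => monic_X_sub_C _

lemma natDegree_nodePoly : (nodePoly lam).natDegree = d := by
  rw [nodePoly, natDegree_prod_of_monic _ _ fun _ _ => monic_X_sub_C _]; simp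

lemma monic_nodePolyErase (i : Fin d) : (nodePolyErase lam i).Monic :=
  monic_prod_of_monic _ _ fun _ _ => monic_X_sub_C _

lemma natDegree_nodePolyErase (i : Fin d) : (nodePolyErase lam i).natDegree = d - 1 := by
  rw [nodePolyErase, natDegree_prod_of_monic _ _ fun _ _ => monic_X_sub_C _]; simp

lemma coeff_logDerivNum : (logDerivNum lam w).coeff (d - 1) = ∑ i, w i := by
  simp only [logDerivNum, finsetSum_coeff, coeff_C_mul]
  refine Finset.sum_congr rfl fun i _ => ?_
  rw [← natDegree_nodePolyErase lam i, (monic_nodePolyErase lam i).coeff_natDegree, mul_one]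

lemma natDegree_logDerivNum_le : (logDerivNum lam w).natDegree ≤ d - 1 :=
  natDegree_sum_le_of_forall_le _ _ fun i _ =>
    (natDegree_C_mul_le _ _).trans (natDegree_nodePolyErase lam i).le

lemma eval_nodePoly_ne_zero {x : ℝ} (hx : ∀ i, x ≠ lam i) : (nodePoly lam).eval x ≠ 0 := by
  simp [nodePoly, eval_prod, Finset.prod_ne_zero_iff, sub_ne_zero, hx]

lemma eval_nodePolyErase {x : ℝ} (hx : ∀ i, x ≠ lam i) (i : Fin d) :
    (nodePolyErase lam i).eval x = (nodePoly lam).eval x / (x - lam i) := by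
  rw [eq_div_iff (sub_ne_zero.2 (hx i)), ← X_sub_C_mul_nodePolyErase lam i]
  simp [mul_comm]

lemma eval_logDerivNum {x : ℝ} (hx : ∀ i, x ≠ lam i) :
    (logDerivNum lam w).eval x = (nodePoly lam).eval x * ∑ i, w i / (x - lam i) := by
  simp only [logDerivNum, eval_finsetSum, eval_mul, eval_C, eval_nodePolyErase lam hx,
    Finset.mul_sum]
  exact Finset.sum_congr rfl fun i _ => by ring

lemma eval_reducedDiffPoly (α : ℝ) {x : ℝ} (hx : ∀ i, x ≠ lam i) :
    (reducedDiffPoly α lam w).eval x = (nodePoly lam).eval x ^ 2 *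
      (α * (∑ i, w i / (x - lam i)) ^ 2 - ∑ i, w i / (x - lam i) ^ 2) := by
  simp only [reducedDiffPoly, eval_sub, eval_mul, eval_C, eval_pow, eval_logDerivNum lam w hx,
    eval_finsetSum, eval_nodePolyErase lam hx, mul_sub]
  congr 1
  · ring
  · rw [Finset.mul_sum]
    exact Finset.sum_congr rfl fun i _ => by rw [div_pow]; ring

variable {lam} in
lemma eval_nodePolyErase_self_ne_zero (hl : Function.Injective lam) (i : Fin d) :
    (nodePolyErase lam i).eval (lam i) ≠ 0 := by
  simp only [nodePolyErase, eval_prod, Finset.prod_ne_zero_iff, eval_sub, eval_X, eval_C]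
  intro j hj
  exact sub_ne_zero.2 fun h => Finset.ne_of_mem_erase hj (hl h).symm

lemma eval_nodePolyErase_of_ne {i j : Fin d} (hij : i ≠ j) :
    (nodePolyErase lam j).eval (lam i) = 0 := by
  simp only [nodePolyErase, eval_prod]
  exact Finset.prod_eq_zero (Finset.mem_erase.2 ⟨hij, Finset.mem_univ i⟩) (by simp)

lemma eval_logDerivNum_node (i : Fin d) :
    (logDerivNum lam w).eval (lam i) = w i * (nodePolyErase lam i).eval (lam i) := by
  simp only [logDerivNum, eval_mul, eval_C, eval_finsetSum]
  rw [Finset.sum_eq_single i]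
  · intro j _ hj; simp [eval_nodePolyErase_of_ne lam hj.symm]
  · simp

lemma eval_reducedDiffPoly_node (α : ℝ) (i : Fin d) :
    (reducedDiffPoly α lam w).eval (lam i) =
      w i * (α * w i - 1) * (nodePolyErase lam i).eval (lam i) ^ 2 := by
  simp only [reducedDiffPoly, eval_sub, eval_mul, eval_C, eval_pow, eval_finsetSum,
    eval_logDerivNum_node]
  rw [Finset.sum_eq_single i]
  · ring
  · intro j _ hj; simp [eval_nodePolyErase_of_ne lam hj.symm]
  · simp

/-- `F_κ[p]` is a product of linear factors times the numerator of `q' + (1 - κ) q²`. -/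
lemma diffPoly_eq_mul (κ a : ℝ) (mult : Fin d → ℕ) (hm : ∀ i, 0 < mult i) :
    diffPoly κ (C a * ∏ i, (X - C (lam i)) ^ mult i) =
      (C a * ∏ i, (X - C (lam i)) ^ (mult i - 1)) ^ 2 *
        reducedDiffPoly (1 - κ) lam (fun i => mult i) := by
  set P := C a * ∏ i, (X - C (lam i)) ^ (mult i - 1) with hP
  set V := logDerivNum lam (fun i => (mult i : ℝ)) with hV
  set p := C a * ∏ i, (X - C (lam i)) ^ mult i with hp
  have h1 : p = P * nodePoly lam := by
    rw [hp, hP, nodePoly, mul_assoc, ← Finset.prod_mul_distrib]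
    congr 1
    refine Finset.prod_congr rfl fun i _ => ?_
    rw [← pow_succ, Nat.sub_add_cancel (hm i)]
  have h2 : derivative p = P * V := by
    rw [hp, derivative_C_mul, derivative_prod_finset, hP, mul_assoc, hV, logDerivNum]
    congr 1
    rw [Finset.mul_sum]
    refine Finset.sum_congr rfl fun i _ => ?_
    rw [derivative_X_sub_C_pow, nodePolyErase, ← Finset.mul_prod_erase Finset.univ
      (fun i => (X - C (lam i)) ^ (mult i - 1)) (Finset.mem_univ i)]
    have : ∏ j ∈ Finset.univ.erase i, (X - C (lam j)) ^ mult j =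
        (∏ j ∈ Finset.univ.erase i, (X - C (lam j)) ^ (mult j - 1)) *
          ∏ j ∈ Finset.univ.erase i, (X - C (lam j)) := by
      rw [← Finset.prod_mul_distrib]
      refine Finset.prod_congr rfl fun j _ => ?_
      rw [← pow_succ, Nat.sub_add_cancel (hm j)]
    rw [this]
    ring
  have h3 : derivative P * nodePoly lam + P * derivative (nodePoly lam) = P * V := by
    rw [← h2, h1, derivative_mul (f := P)]
  have h4 := nodePoly_wronskian lam (fun i => (mult i : ℝ))
  rw [← hV] at h4
  rw [diffPoly, h2, derivative_mul, reducedDiffPoly, ← h4, ← hV, h1, C_sub, C_1]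
  linear_combination P * V * h3

end Nodes

/-! ### Zeroes of q and partial fractions of 1/q -/

section Critical

variable {m : ℕ} {lam : Fin (m + 1) → ℝ} {w : Fin (m + 1) → ℝ}

/-- Between consecutive nodes the numerator of `∑ w i / (X - lam i)` has a root. -/
lemma exists_root_logDerivNum (hl : StrictMono lam) (hw : ∀ i, 0 < w i) (i : Fin m) :
    ∃ μ, lam i.castSucc < μ ∧ μ < lam i.succ ∧ (logDerivNum lam w).eval μ = 0 := by
  have hlt : lam i.castSucc < lam i.succ := hl Fin.castSucc_lt_succ
  have hne : i.castSucc ≠ i.succ := Fin.castSucc_lt_succ.ne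
  have hsign : (logDerivNum lam w).eval (lam i.castSucc) *
      (logDerivNum lam w).eval (lam i.succ) < 0 := by
    rw [eval_logDerivNum_node, eval_logDerivNum_node]
    have hE : (nodePolyErase lam i.castSucc).eval (lam i.castSucc) *
        (nodePolyErase lam i.succ).eval (lam i.succ) < 0 := by
      simp only [nodePolyErase, eval_prod, eval_sub, eval_X, eval_C]
      -- Every other node lies on the same side of both neighbours, so its two factors have positive
      -- product; only the mutual factors of the neighbours give the sign.
      rw [← Finset.mul_prod_erase (Finset.univ.erase i.castSucc) _
          (Finset.mem_erase.2 ⟨hne.symm, Finset.mem_univ i.succ⟩),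
        ← Finset.mul_prod_erase (Finset.univ.erase i.succ) _
          (Finset.mem_erase.2 ⟨hne, Finset.mem_univ i.castSucc⟩),
        Finset.erase_right_comm, mul_mul_mul_comm, ← Finset.prod_mul_distrib]
      refine mul_neg_of_neg_of_pos
        (mul_neg_of_neg_of_pos (sub_neg.2 hlt) (sub_pos.2 hlt)) (Finset.prod_pos fun j hj => ?_)
      have h1 := Finset.ne_of_mem_erase hj
      have h2 := Finset.ne_of_mem_erase (Finset.mem_of_mem_erase hj)
      rcases lt_or_gt_of_ne h1 with h | h
      · have h' : j < i.succ := h.trans Fin.castSucc_lt_succ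
        exact mul_pos (sub_pos.2 (hl h)) (sub_pos.2 (hl h'))
      · have h' : i.succ < j := lt_of_le_of_ne (Fin.castSucc_lt_iff_succ_le.1 h) h2.symm
        exact mul_pos_of_neg_of_neg (sub_neg.2 (hl h)) (sub_neg.2 (hl h'))
    have := mul_neg_of_pos_of_neg (mul_pos (hw i.castSucc) (hw i.succ)) hE
    linarith
  have hcont := (logDerivNum lam w).continuousOn (s := Set.Icc (lam i.castSucc) (lam i.succ))
  rcases mul_neg_iff.1 hsign with ⟨h1, h2⟩ | ⟨h1, h2⟩
  · obtain ⟨μ, hμ, h⟩ := intermediate_value_Ioo' hlt.le hcont ⟨h2, h1⟩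
    exact ⟨μ, hμ.1, hμ.2, h⟩
  · obtain ⟨μ, hμ, h⟩ := intermediate_value_Ioo hlt.le hcont ⟨h1, h2⟩
    exact ⟨μ, hμ.1, hμ.2, h⟩

/-- The m gaps each supply one root, which exhausts the degree; so the zeroes of q are real and
simple. -/
lemma exists_roots_logDerivNum (hl : StrictMono lam) (hw : ∀ i, 0 < w i) :
    ∃ S : Finset ℝ, S.card = m ∧ (∀ μ ∈ S, ∀ i, μ ≠ lam i) ∧
      logDerivNum lam w = C (∑ i, w i) * ∏ μ ∈ S, (X - C μ) := by
  choose μ h1 h2 h3 using exists_root_logDerivNum hl hw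
  have hmono : StrictMono μ := by
    intro i j hij
    exact (h2 i).trans_le ((hl.monotone (Fin.succ_le_castSucc_iff.2 hij)).trans (h1 j).le)
  refine ⟨Finset.univ.image μ, ?_, ?_, ?_⟩
  · rw [Finset.card_image_of_injective _ hmono.injective, Finset.card_fin]
  · intro x hx i
    obtain ⟨j, -, rfl⟩ := Finset.mem_image.1 hx
    intro h
    have := h3 j
    rw [h, eval_logDerivNum_node] at this
    exact mul_ne_zero (hw i).ne' (eval_nodePolyErase_self_ne_zero hl.injective i) this
  · have hA : 0 < ∑ i, w i := Finset.sum_pos (fun i _ => hw i) Finset.univ_nonempty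
    have hcoeff := coeff_logDerivNum lam w
    rw [Nat.add_sub_cancel] at hcoeff
    have hdeg : (logDerivNum lam w).natDegree = m :=
      le_antisymm (natDegree_logDerivNum_le lam w) (le_natDegree_of_ne_zero (hcoeff ▸ hA.ne'))
    have hne : logDerivNum lam w ≠ 0 := by
      intro h
      rw [h, coeff_zero] at hcoeff
      exact hA.ne hcoeff
    have hle : (Finset.univ.image μ).val ≤ (logDerivNum lam w).roots := by
      rw [Multiset.le_iff_subset (Finset.nodup _)]
      intro x hx
      rw [Finset.mem_val, Finset.mem_image] at hx
      obtain ⟨j, -, rfl⟩ := hx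
      exact (mem_roots hne).2 (h3 j)
    have hcard : (Finset.univ.image μ).val.card = m := by
      rw [Finset.card_val, Finset.card_image_of_injective _ hmono.injective, Finset.card_fin]
    have hroots : (Finset.univ.image μ).val = (logDerivNum lam w).roots :=
      Multiset.eq_of_le_of_card_le hle ((card_roots' _).trans (hdeg.trans hcard.symm).le)
    have := C_leadingCoeff_mul_prod_multiset_X_sub_C (p := logDerivNum lam w)
      (by rw [← hroots, hcard, hdeg])
    rw [← hroots, leadingCoeff, hdeg, hcoeff] at this
    exact this.symm

/-- The partial fraction expansion of the derivative of the reciprocal of `∑ w i / (X - lam i)`,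
with denominators cleared. -/
lemma exists_partialFraction (hw : ∀ i, 0 < w i) (S : Finset ℝ)
    (hS : S.card = m) (hSl : ∀ μ ∈ S, ∀ i, μ ≠ lam i)
    (hV : logDerivNum lam w = C (∑ i, w i) * ∏ μ ∈ S, (X - C μ)) :
    ∃ c : ℝ → ℝ, (∀ μ ∈ S, 0 < c μ) ∧
      ∑ i, C (w i) * nodePolyErase lam i ^ 2 =
        C (∑ i, w i) * ((∏ μ ∈ S, (X - C μ)) ^ 2 +
          ∑ μ ∈ S, C (c μ) * (∏ ν ∈ S.erase μ, (X - C ν)) ^ 2) := by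
  have hA : 0 < ∑ i, w i := Finset.sum_pos (fun i _ => hw i) Finset.univ_nonempty
  set W := ∏ μ ∈ S, (X - C μ) with hW
  have hWm : W.Monic := monic_prod_of_monic _ _ fun _ _ => monic_X_sub_C _
  have hWd : W.natDegree = m := by
    rw [hW, natDegree_prod_of_monic _ _ fun _ _ => monic_X_sub_C _]; simp [hS]
  have hdegle : W.degree ≤ (nodePoly lam).degree := by
    rw [degree_eq_natDegree hWm.ne_zero, degree_eq_natDegree (monic_nodePoly lam).ne_zero, hWd,
      natDegree_nodePoly]
    exact_mod_cast Nat.le_succ m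
  obtain ⟨e, he⟩ : ∃ e, nodePoly lam /ₘ W = X + C e := by
    refine ⟨_, Monic.eq_X_add_C ?_ ?_⟩
    · rw [Monic, leadingCoeff_divByMonic_of_monic hWm hdegle]
      exact monic_nodePoly lam
    · rw [natDegree_divByMonic _ hWm, natDegree_nodePoly, hWd]; omega
  set r := nodePoly lam %ₘ W with hr
  have hdiv : nodePoly lam = r + W * (X + C e) := by
    rw [← he, hr, modByMonic_add_div]
  have hrdeg : r.degree < S.card := by
    rw [hS, ← hWd, ← degree_eq_natDegree hWm.ne_zero]
    exact degree_modByMonic_lt _ hWm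
  -- Lagrange interpolation at S. The minus sign makes c the coefficients of 1/(X - μ)² in the
  -- derivative of r/W.
  obtain ⟨c, hc⟩ : ∃ c : ℝ → ℝ, r = - ∑ μ ∈ S, C (c μ) * ∏ ν ∈ S.erase μ, (X - C ν) := by
    refine ⟨fun μ => -(r.eval μ * ∏ ν ∈ S.erase μ, (μ - ν)⁻¹), ?_⟩
    refine (Lagrange.eq_interpolate (v := id) Function.injective_id.injOn hrdeg).trans ?_
    rw [Lagrange.interpolate_apply, ← Finset.sum_neg_distrib]
    refine Finset.sum_congr rfl fun μ _ => ?_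
    simp only [Lagrange.basis, Lagrange.basisDivisor, id, Finset.prod_mul_distrib, map_neg, map_mul,
      map_prod]
    ring
  have key : ∑ i, C (w i) * nodePolyErase lam i ^ 2 =
      C (∑ i, w i) * (W ^ 2 + ∑ μ ∈ S, C (c μ) * (∏ ν ∈ S.erase μ, (X - C ν)) ^ 2) := by
    have hres : derivative r * W - r * derivative W =
        ∑ μ ∈ S, C (c μ) * (∏ ν ∈ S.erase μ, (X - C ν)) ^ 2 := by
      rw [hc, derivative_neg, derivative_sum, neg_mul, neg_mul, Finset.sum_mul, Finset.sum_mul,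
        ← Finset.sum_neg_distrib, ← Finset.sum_neg_distrib, ← Finset.sum_sub_distrib]
      refine Finset.sum_congr rfl fun μ hμ => ?_
      rw [derivative_C_mul]
      have := derivative_prod_mul_sub S id hμ
      simp only [id, ← hW] at this
      linear_combination C (c μ) * this
    rw [← nodePoly_wronskian, hV, ← hres, hdiv, derivative_C_mul]
    simp only [derivative_add, derivative_mul, derivative_X, derivative_C]
    ring
  refine ⟨c, fun μ hμ => ?_, key⟩
  -- At μ only the term of μ survives on the right, and the left side is a sum of positive terms.
  have hev := congrArg (eval μ) key
  have hL := eval_nodePoly_ne_zero lam (hSl μ hμ)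
  have hpos : 0 < eval μ (∑ i, C (w i) * nodePolyErase lam i ^ 2) := by
    rw [eval_finsetSum]
    refine Finset.sum_pos (fun i _ => ?_) Finset.univ_nonempty
    rw [eval_mul, eval_C, eval_pow, eval_nodePolyErase lam (hSl μ hμ)]
    have := div_ne_zero hL (sub_ne_zero.2 (hSl μ hμ i))
    have := hw i
    positivity
  have hW0 : W.eval μ = 0 := by
    rw [hW, eval_prod]; exact Finset.prod_eq_zero hμ (by simp)
  rw [hev, eval_mul, eval_add, eval_pow, hW0, eval_C, eval_finsetSum, Finset.sum_eq_single μ] at hpos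
  · rw [eval_mul, eval_C, eval_pow, zero_pow two_ne_zero, zero_add] at hpos
    exact pos_of_mul_pos_left (pos_of_mul_pos_right hpos hA.le) (sq_nonneg _)
  · intro ν hν hne
    rw [eval_mul, eval_pow, eval_prod,
      Finset.prod_eq_zero (Finset.mem_erase.2 ⟨hne.symm, hμ⟩) (by simp)]
    simp
  · exact fun h => absurd hμ h

end Critical

/-! ### Position of the roots relative to nodes and zeroes of q -/

section Location

variable {m : ℕ} {lam w : Fin (m + 1) → ℝ}

lemma div_sub_lt_div_sub {a l x y : ℝ} (ha : 0 < a) (hxy : x < y) (h : 0 < (x - l) * (y - l)) :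
    a / (y - l) < a / (x - l) := by
  have hx := left_ne_zero_of_mul h.ne'
  have hy := right_ne_zero_of_mul h.ne'
  have h1 : a / (x - l) - a / (y - l) = a * (y - x) / ((x - l) * (y - l)) := by
    field_simp; ring
  have h2 : 0 < a * (y - x) / ((x - l) * (y - l)) :=
    div_pos (mul_pos ha (sub_pos.2 hxy)) h
  linarith

lemma sum_div_sub_strictAnti (hw : ∀ i, 0 < w i) {x y : ℝ} (hxy : x < y)
    (h : ∀ i, 0 < (x - lam i) * (y - lam i)) :
    ∑ i, w i / (y - lam i) < ∑ i, w i / (x - lam i) :=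
  Finset.sum_lt_sum_of_nonempty Finset.univ_nonempty fun i _ =>
    div_sub_lt_div_sub (hw i) hxy (h i)

/-- The number of nodes to the left of `x`. -/
noncomputable def nodesBelow (lam : Fin (m + 1) → ℝ) (x : ℝ) : ℕ :=
  (Finset.univ.filter fun i => lam i < x).card

lemma nodesBelow_le (x : ℝ) : nodesBelow lam x ≤ m + 1 :=
  (Finset.card_le_univ _).trans (Fintype.card_fin _).le

lemma lt_iff_lt_nodesBelow (hl : StrictMono lam) (x : ℝ) (i : Fin (m + 1)) :
    lam i < x ↔ (i : ℕ) < nodesBelow lam x := by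
  constructor
  · intro h
    have : (Finset.Iic i).card ≤ nodesBelow lam x := by
      refine Finset.card_le_card fun j hj => ?_
      exact Finset.mem_filter.2 ⟨Finset.mem_univ _,
        (hl.monotone (Finset.mem_Iic.1 hj)).trans_lt h⟩
    rw [Fin.card_Iic] at this
    omega
  · intro h
    by_contra hx
    have : nodesBelow lam x ≤ (Finset.Iio i).card := by
      refine Finset.card_le_card fun j hj => ?_
      exact Finset.mem_Iio.2 (hl.lt_iff_lt.1 ((Finset.mem_filter.1 hj).2.trans_le (not_lt.1 hx)))
    rw [Fin.card_Iio] at this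
    omega

variable {α : ℝ} {k : ℕ}

/-- At a root of `α q² + q'` the partial sums of `q = ∑ w i / (x - lam i)` over few nodes are
smaller than `q`. -/
lemma sq_sum_lt_sq_sum (hw : ∀ i, 0 < w i) (hα : 0 < α) {x : ℝ} (hx : ∀ i, x ≠ lam i)
    (hroot : α * (∑ i, w i / (x - lam i)) ^ 2 = ∑ i, w i / (x - lam i) ^ 2)
    {T : Finset (Fin (m + 1))} (hT : T ≠ Finset.univ) (hTw : α * ∑ i ∈ T, w i ≤ 1) :
    (∑ i ∈ T, w i / (x - lam i)) ^ 2 < (∑ i, w i / (x - lam i)) ^ 2 := by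
  have hpos : ∀ i, 0 < w i / (x - lam i) ^ 2 := fun i =>
    div_pos (hw i) (sq_pos_of_ne_zero (sub_ne_zero.2 (hx i)))
  -- Cauchy–Schwarz with weights w; strictness comes later from a node outside T.
  have h1 : (∑ i ∈ T, w i / (x - lam i)) ^ 2 ≤
      (∑ i ∈ T, w i) * ∑ i ∈ T, w i / (x - lam i) ^ 2 :=
    Finset.sum_sq_le_sum_mul_sum_of_sq_le_mul T (fun i _ => (hw i).le) (fun i _ => (hpos i).le)
      fun i _ => by rw [div_pow]; exact le_of_eq (by ring)
  obtain ⟨j, hj⟩ : ∃ j, j ∉ T := by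
    by_contra! h
    exact hT (Finset.eq_univ_iff_forall.2 h)
  have h2 : ∑ i ∈ T, w i / (x - lam i) ^ 2 < ∑ i, w i / (x - lam i) ^ 2 :=
    Finset.sum_lt_sum_of_subset (Finset.subset_univ T) (Finset.mem_univ j) hj (hpos j)
      fun i _ _ => (hpos i).le
  have h3 : 0 ≤ ∑ i ∈ T, w i / (x - lam i) ^ 2 := Finset.sum_nonneg fun i _ => (hpos i).le
  have h4 := mul_le_mul_of_nonneg_left h1 hα.le
  have h5 := mul_le_mul_of_nonneg_right hTw h3
  have h6 : α * (∑ i ∈ T, w i / (x - lam i)) ^ 2 < α * (∑ i, w i / (x - lam i)) ^ 2 := by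
    rw [hroot]; linarith
  exact lt_of_mul_lt_mul_left h6 hα.le

/-- The real roots of `α q² + q'` for `q = ∑ w i / (x - lam i)`. -/
structure IsCriticalPoint (α : ℝ) (lam w : Fin (m + 1) → ℝ) (x : ℝ) : Prop where
  ne_node : ∀ i, x ≠ lam i
  eq : α * (∑ i, w i / (x - lam i)) ^ 2 = ∑ i, w i / (x - lam i) ^ 2

lemma IsCriticalPoint.sum_ne_zero (hw : ∀ i, 0 < w i) {x : ℝ} (hx : IsCriticalPoint α lam w x) :
    ∑ i, w i / (x - lam i) ≠ 0 := by
  intro h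
  have := hx.eq
  rw [h, zero_pow two_ne_zero, mul_zero] at this
  refine (Finset.sum_pos (fun i _ => ?_) Finset.univ_nonempty).ne this
  have h1 := hw i
  have h2 := sub_ne_zero.2 (hx.ne_node i)
  positivity

lemma IsCriticalPoint.lt_of_not_lt {x : ℝ} (hx : IsCriticalPoint α lam w x) {i : Fin (m + 1)}
    (h : ¬ lam i < x) : x < lam i := lt_of_le_of_ne (not_lt.1 h) (hx.ne_node i)

section Few

variable (hl : StrictMono lam) (hw : ∀ i, 0 < w i) (hα : 0 < α) (hkm : k ≤ m)
  (hT : ∀ T : Finset (Fin (m + 1)), T.card ≤ k → α * ∑ i ∈ T, w i ≤ 1)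

include hw hα hkm hT

lemma IsCriticalPoint.sq_sum_lt {x : ℝ} (hx : IsCriticalPoint α lam w x)
    {T : Finset (Fin (m + 1))} (hcard : T.card ≤ k) :
    (∑ i ∈ T, w i / (x - lam i)) ^ 2 < (∑ i, w i / (x - lam i)) ^ 2 := by
  refine sq_sum_lt_sq_sum hw hα hx.ne_node hx.eq ?_ (hT T hcard)
  rintro rfl
  rw [Finset.card_fin] at hcard
  omega

lemma IsCriticalPoint.sum_compl_pos {x : ℝ} (hx : IsCriticalPoint α lam w x)
    {T : Finset (Fin (m + 1))} (hcard : T.card ≤ k) (hq : 0 < ∑ i, w i / (x - lam i)) :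
    0 < ∑ i ∈ Tᶜ, w i / (x - lam i) := by
  have h1 := lt_of_pow_lt_pow_left₀ 2 hq.le (hx.sq_sum_lt hw hα hkm hT hcard)
  have h2 := Finset.sum_add_sum_compl T fun i => w i / (x - lam i)
  linarith

lemma IsCriticalPoint.sum_compl_neg {x : ℝ} (hx : IsCriticalPoint α lam w x)
    {T : Finset (Fin (m + 1))} (hcard : T.card ≤ k) (hq : ∑ i, w i / (x - lam i) < 0) :
    ∑ i ∈ Tᶜ, w i / (x - lam i) < 0 := by
  have h := hx.sq_sum_lt hw hα hkm hT hcard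
  rw [← neg_sq (∑ i ∈ T, _), ← neg_sq (∑ i, w i / (x - lam i))] at h
  have h1 := lt_of_pow_lt_pow_left₀ 2 (neg_nonneg.2 hq.le) h
  have h2 := Finset.sum_add_sum_compl T fun i => w i / (x - lam i)
  linarith

/-- If at most k nodes lay to the left, discarding them would leave only nonpositive terms, yet the
remaining sum is positive. -/
lemma IsCriticalPoint.lt_nodesBelow {x : ℝ} (hx : IsCriticalPoint α lam w x)
    (hq : 0 < ∑ i, w i / (x - lam i)) : k < nodesBelow lam x := by
  by_contra! hle
  refine (hx.sum_compl_pos hw hα hkm hT (T := Finset.univ.filter fun i => lam i < x) hle hq).not_ge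
    (Finset.sum_nonpos fun i hi => div_nonpos_of_nonneg_of_nonpos (hw i).le ?_)
  simp only [Finset.mem_compl, Finset.mem_filter, Finset.mem_univ, true_and] at hi
  exact sub_nonpos.2 (not_lt.1 hi)

lemma IsCriticalPoint.nodesBelow_add_le {x : ℝ} (hx : IsCriticalPoint α lam w x)
    (hq : ∑ i, w i / (x - lam i) < 0) : nodesBelow lam x + k ≤ m := by
  by_contra! hle
  have hcard : (Finset.univ.filter fun i => lam i < x)ᶜ.card ≤ k := by
    rw [Finset.card_compl, Fintype.card_fin]
    have : (Finset.univ.filter fun i => lam i < x).card = nodesBelow lam x := rfl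
    omega
  refine (hx.sum_compl_neg hw hα hkm hT hcard hq).not_ge (Finset.sum_nonneg fun i hi => ?_)
  rw [compl_compl, Finset.mem_filter] at hi
  exact div_nonneg (hw i).le (sub_nonneg.2 hi.2.le)

-- This keeps labels from mixing signs. Drop the k nodes lying between y and x: the remaining sum
-- has no pole on [y, x], so it decreases from y to x, but it would be negative at y and positive at
-- x.
include hl in
lemma IsCriticalPoint.nodesBelow_ne_add (hk : 0 < k) {x y : ℝ} (hx : IsCriticalPoint α lam w x)
    (hy : IsCriticalPoint α lam w y) (hqx : 0 < ∑ i, w i / (x - lam i))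
    (hqy : ∑ i, w i / (y - lam i) < 0) : nodesBelow lam x ≠ nodesBelow lam y + k := by
  intro hc
  set v := nodesBelow lam y with hv
  let T : Finset (Fin (m + 1)) := Finset.univ.filter fun i => v ≤ (i : ℕ) ∧ (i : ℕ) < v + k
  have hcard : T.card ≤ k := by
    rw [← Finset.card_map Fin.valEmbedding]
    have : T.map Fin.valEmbedding ⊆ Finset.Ico v (v + k) := by
      intro j hj
      obtain ⟨i, hi, rfl⟩ := Finset.mem_map.1 hj
      exact Finset.mem_Ico.2 (Finset.mem_filter.1 hi).2
    simpa using Finset.card_le_card this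
  have h1 := hx.sum_compl_pos hw hα hkm hT hcard hqx
  have h2 := hy.sum_compl_neg hw hα hkm hT hcard hqy
  have hle := nodesBelow_le (lam := lam) x
  have hyx : y < x := by
    have hi : v < m + 1 := by omega
    have h3 : ¬ lam ⟨v, hi⟩ < y := by rw [lt_iff_lt_nodesBelow hl]; simp [hv]
    have h4 : lam ⟨v, hi⟩ < x := by
      rw [lt_iff_lt_nodesBelow hl, hc]; simp [hk]
    exact (not_lt.1 h3).trans_lt h4
  refine (h2.trans h1).not_ge (Finset.sum_le_sum fun i hi => ?_)
  refine (div_sub_lt_div_sub (hw i) hyx ?_).le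
  simp only [T, Finset.mem_compl, Finset.mem_filter, Finset.mem_univ, true_and, not_and, not_lt]
    at hi
  by_cases hiv : v ≤ (i : ℕ)
  · have h3 := hy.lt_of_not_lt (i := i) (by rw [lt_iff_lt_nodesBelow hl]; omega)
    have h4 := hx.lt_of_not_lt (i := i) (by rw [lt_iff_lt_nodesBelow hl]; have := hi hiv; omega)
    exact mul_pos_of_neg_of_neg (sub_neg.2 h3) (sub_neg.2 h4)
  · have h3 := (lt_iff_lt_nodesBelow hl y i).2 (by omega)
    exact mul_pos (sub_pos.2 h3) (sub_pos.2 (h3.trans hyx))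

end Few

/-- Critical points in the same gap between nodes at which `q` has the same sign are not separated
by roots of `q`. -/
lemma IsCriticalPoint.mul_sub_pos (hl : StrictMono lam) (hw : ∀ i, 0 < w i) {x y μ : ℝ}
    (hx : IsCriticalPoint α lam w x) (hy : IsCriticalPoint α lam w y) (hμ : ∀ i, μ ≠ lam i)
    (hqμ : ∑ i, w i / (μ - lam i) = 0) (hc : nodesBelow lam x = nodesBelow lam y)
    (hq : 0 < ∑ i, w i / (x - lam i) ↔ 0 < ∑ i, w i / (y - lam i)) :
    0 < (x - μ) * (y - μ) := by
  wlog hxy : x ≤ y generalizing x y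
  · rw [mul_comm]
    exact this hy hx hc.symm hq.symm (le_of_not_ge hxy)
  have hxμ : x ≠ μ := by rintro rfl; exact hx.sum_ne_zero hw hqμ
  have hyμ : y ≠ μ := by rintro rfl; exact hy.sum_ne_zero hw hqμ
  by_contra hneg
  have h1 : x < μ := by
    by_contra h
    have h' : μ < x := lt_of_le_of_ne (not_lt.1 h) hxμ.symm
    exact hneg (mul_pos (sub_pos.2 h') (sub_pos.2 (h'.trans_le hxy)))
  have h2 : μ < y := by
    by_contra h
    have h' : y < μ := lt_of_le_of_ne (not_lt.1 h) hyμ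
    exact hneg (mul_pos_of_neg_of_neg (sub_neg.2 h1) (sub_neg.2 h'))
  have hside : ∀ i, (lam i < x ∧ lam i < μ) ∨ (y < lam i ∧ μ < lam i) := by
    intro i
    by_cases hi : lam i < x
    · exact Or.inl ⟨hi, hi.trans h1⟩
    · rw [lt_iff_lt_nodesBelow hl, hc, ← lt_iff_lt_nodesBelow hl] at hi
      have := hy.lt_of_not_lt hi
      exact Or.inr ⟨this, h2.trans this⟩
  have h3 : 0 < ∑ i, w i / (x - lam i) := by
    rw [← hqμ]
    refine sum_div_sub_strictAnti hw h1 fun i => ?_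
    rcases hside i with ⟨h, h'⟩ | ⟨h, h'⟩
    · exact mul_pos (sub_pos.2 h) (sub_pos.2 h')
    · exact mul_pos_of_neg_of_neg (sub_neg.2 (hxy.trans_lt h)) (sub_neg.2 h')
  have h4 : ∑ i, w i / (y - lam i) < 0 := by
    rw [← hqμ]
    refine sum_div_sub_strictAnti hw h2 fun i => ?_
    rcases hside i with ⟨h, h'⟩ | ⟨h, h'⟩
    · exact mul_pos (sub_pos.2 h') (sub_pos.2 (h.trans_le hxy))
    · exact mul_pos_of_neg_of_neg (sub_neg.2 h') (sub_neg.2 h)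
  exact h4.not_gt (hq.1 h3)

lemma lt_root_of_nodesBelow_eq_zero (hl : StrictMono lam) (hw : ∀ i, 0 < w i) {x μ : ℝ}
    (hμ : ∀ i, μ ≠ lam i) (hqμ : ∑ i, w i / (μ - lam i) = 0) (hc : nodesBelow lam x = 0) :
    x < μ := by
  by_contra! h
  refine (Finset.sum_neg (fun i _ => ?_) Finset.univ_nonempty).ne hqμ
  have : ¬ lam i < x := by rw [lt_iff_lt_nodesBelow hl, hc]; simp
  exact div_neg_of_pos_of_neg (hw i)
    (sub_neg.2 (lt_of_le_of_ne (h.trans (not_lt.1 this)) (hμ i)))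

lemma root_lt_of_nodesBelow_eq (hl : StrictMono lam) (hw : ∀ i, 0 < w i) {x μ : ℝ}
    (hqμ : ∑ i, w i / (μ - lam i) = 0) (hc : nodesBelow lam x = m + 1) :
    μ < x := by
  by_contra! h
  refine (Finset.sum_pos (fun i _ => ?_) Finset.univ_nonempty).ne' hqμ
  have : lam i < x := by rw [lt_iff_lt_nodesBelow hl, hc]; exact i.2
  exact div_pos (hw i) (sub_pos.2 (this.trans_le h))

end Location

/-! ### Counting roots by labels -/

lemma exists_le_card_eq {β : Type*} {s : Multiset β} {n : ℕ} (h : n ≤ s.card) :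
    ∃ t ≤ s, t.card = n := by
  have : 0 < (s.powersetCard n).card := by
    rw [Multiset.card_powersetCard]; exact Nat.choose_pos h
  obtain ⟨t, ht⟩ := Multiset.card_pos_iff_exists_mem.1 this
  exact ⟨t, Multiset.mem_powersetCard.1 ht⟩

lemma card_le_one_of_not_dvd {f : ℝ[X]} (hf : f ≠ 0) (P : ℝ → Prop) [DecidablePred P]
    (h : ∀ x y, P x → P y → IsRoot f x → IsRoot f y → ¬ (X - C x) * (X - C y) ∣ f) :
    (f.roots.filter P).card ≤ 1 := by
  by_contra! hc
  obtain ⟨t, ht, htc⟩ := exists_le_card_eq hc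
  obtain ⟨x, y, rfl⟩ := Multiset.card_eq_two.1 htc
  have hx := Multiset.mem_filter.1 (Multiset.mem_of_le ht (by simp : x ∈ ({x, y} : Multiset ℝ)))
  have hy := Multiset.mem_filter.1 (Multiset.mem_of_le ht (by simp : y ∈ ({x, y} : Multiset ℝ)))
  refine h x y hx.2 hy.2 (isRoot_of_mem_roots hx.1) (isRoot_of_mem_roots hy.1) ?_
  have := (Multiset.prod_X_sub_C_dvd_iff_le_roots hf {x, y}).2
    (ht.trans (Multiset.filter_le _ _))
  simpa using this

lemma card_le_two_of_not_dvd {f : ℝ[X]} (hf : f ≠ 0) (P : ℝ → Prop) [DecidablePred P]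
    (h : ∀ x y z, P x → P y → P z → IsRoot f x → IsRoot f y → IsRoot f z →
      ¬ (X - C x) * ((X - C y) * (X - C z)) ∣ f) :
    (f.roots.filter P).card ≤ 2 := by
  by_contra! hc
  obtain ⟨t, ht, htc⟩ := exists_le_card_eq hc
  obtain ⟨x, y, z, rfl⟩ := Multiset.card_eq_three.1 htc
  have hx := Multiset.mem_filter.1 (Multiset.mem_of_le ht (by simp : x ∈ ({x, y, z} : Multiset ℝ)))
  have hy := Multiset.mem_filter.1 (Multiset.mem_of_le ht (by simp : y ∈ ({x, y, z} : Multiset ℝ)))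
  have hz := Multiset.mem_filter.1 (Multiset.mem_of_le ht (by simp : z ∈ ({x, y, z} : Multiset ℝ)))
  refine h x y z hx.2 hy.2 hz.2 (isRoot_of_mem_roots hx.1) (isRoot_of_mem_roots hy.1)
    (isRoot_of_mem_roots hz.1) ?_
  have := (Multiset.prod_X_sub_C_dvd_iff_le_roots hf {x, y, z}).2
    (ht.trans (Multiset.filter_le _ _))
  simpa using this

/-- A multiset labelled by `0, …, N + 1` with at most one element carrying each extreme label and at
most two elements carrying each other label. -/
lemma card_le_of_labels {β : Type*} (R : Multiset β) (lab : β → ℕ) (N : ℕ)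
    (hlab : ∀ x ∈ R, lab x ≤ N + 1) (h0 : (R.filter fun x => 0 = lab x).card ≤ 1)
    (hN : (R.filter fun x => N + 1 = lab x).card ≤ 1)
    (h2 : ∀ v, v < N → (R.filter fun x => v + 1 = lab x).card ≤ 2) : R.card ≤ 2 * (N + 1) := by
  have h := Multiset.sum_count_eq_card (s := Finset.range (N + 2)) (m := R.map lab) (by
    intro v hv
    obtain ⟨x, hx, rfl⟩ := Multiset.mem_map.1 hv
    exact Finset.mem_range.2 (Nat.lt_succ_of_le (hlab x hx)))
  rw [Multiset.card_map, Finset.sum_range_succ, Finset.sum_range_succ'] at h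
  simp only [Multiset.count_map] at h
  have h3 := Finset.sum_le_sum fun v (hv : v ∈ Finset.range N) => h2 v (Finset.mem_range.1 hv)
  simp only [Finset.sum_const, Finset.card_range, smul_eq_mul] at h3
  omega

/-! ### The bound for real roots -/

section Count

variable {m : ℕ} {lam w : Fin (m + 1) → ℝ} {α : ℝ} {k : ℕ}

lemma coeff_reducedDiffPoly :
    (reducedDiffPoly α lam w).coeff (2 * m) = (∑ i, w i) * (α * ∑ i, w i - 1) := by
  have h1 : (logDerivNum lam w ^ 2).coeff (2 * m) = (∑ i, w i) ^ 2 := by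
    rw [← coeff_logDerivNum lam w]
    exact coeff_pow_of_natDegree_le (m := 2) (natDegree_logDerivNum_le lam w)
  have h2 : ∀ i, (nodePolyErase lam i ^ 2).coeff (2 * m) = 1 := by
    intro i
    have := coeff_pow_of_natDegree_le (m := 2) (natDegree_nodePolyErase lam i).le
    rw [Nat.add_sub_cancel] at this
    rw [this]
    have := (monic_nodePolyErase lam i).coeff_natDegree
    rw [natDegree_nodePolyErase, Nat.add_sub_cancel] at this
    rw [this, one_pow]
  simp only [reducedDiffPoly, coeff_sub, coeff_C_mul, h1, finsetSum_coeff, h2]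
  simp only [mul_one]
  ring

lemma natDegree_reducedDiffPoly_le : (reducedDiffPoly α lam w).natDegree ≤ 2 * m := by
  refine (natDegree_sub_le _ _).trans (max_le ?_ ?_)
  · exact (natDegree_C_mul_le _ _).trans
      (natDegree_pow_le_of_le 2 (natDegree_logDerivNum_le lam w))
  · refine natDegree_sum_le_of_forall_le _ _ fun i _ => (natDegree_C_mul_le _ _).trans ?_
    exact natDegree_pow_le_of_le 2 (natDegree_nodePolyErase lam i).le

lemma natDegree_reducedDiffPoly (hw : ∀ i, 0 < w i) (hα : α * ∑ i, w i ≠ 1) :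
    (reducedDiffPoly α lam w).natDegree = 2 * m := by
  refine le_antisymm natDegree_reducedDiffPoly_le (le_natDegree_of_ne_zero ?_)
  rw [coeff_reducedDiffPoly]
  exact mul_ne_zero (Finset.sum_pos (fun i _ => hw i) Finset.univ_nonempty).ne' (sub_ne_zero.2 hα)

/-- The value at a node is w_i(αw_i - 1) times a nonzero square, so `hα` keeps roots off the nodes.
-/
lemma isCriticalPoint_of_isRoot (hl : StrictMono lam) (hw : ∀ i, 0 < w i)
    (hα : ∀ i, α * w i ≠ 1) {x : ℝ} (hx : IsRoot (reducedDiffPoly α lam w) x) :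
    IsCriticalPoint α lam w x := by
  have hne : ∀ i, x ≠ lam i := by
    rintro i rfl
    have := eval_reducedDiffPoly_node lam w α i
    rw [hx] at this
    exact mul_ne_zero (mul_ne_zero (hw i).ne' (sub_ne_zero.2 (hα i)))
      (pow_ne_zero 2 (eval_nodePolyErase_self_ne_zero hl.injective i)) this.symm
  refine ⟨hne, ?_⟩
  have := eval_reducedDiffPoly lam w α hne
  rw [hx] at this
  have h := (mul_eq_zero.1 this.symm).resolve_left (pow_ne_zero 2 (eval_nodePoly_ne_zero lam hne))
  linarith

/-- If `k` of the numbers `α w i` never have a sum larger than `1`, then the numerator of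
`q' + α q²` has at most `2 (m + 1 - k)` real roots. -/
theorem card_roots_reducedDiffPoly_le (hm : 0 < m) (hl : StrictMono lam) (hw : ∀ i, 0 < w i)
    (hα : 0 < α) (hαw : ∀ i, α * w i ≠ 1) (hαA : α * ∑ i, w i ≠ 1) (hk : 0 < k) (hkm : k ≤ m)
    (hT : ∀ T : Finset (Fin (m + 1)), T.card ≤ k → α * ∑ i ∈ T, w i ≤ 1) :
    (reducedDiffPoly α lam w).roots.card ≤ 2 * (m + 1 - k) := by
  obtain ⟨S, hS, hSl, hV⟩ := exists_roots_logDerivNum hl hw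
  obtain ⟨c, hc, hpf⟩ := exists_partialFraction hw S hS hSl hV
  set A := ∑ i, w i with hA
  have hA0 : 0 < A := Finset.sum_pos (fun i _ => hw i) Finset.univ_nonempty
  have hSne : S.Nonempty := Finset.card_pos.1 (by omega)
  have hG : reducedDiffPoly α lam w = C (α * A ^ 2 - A) * (∏ μ ∈ S, (X - C μ)) ^ 2 -
      ∑ μ ∈ S, C (A * c μ) * (∏ ν ∈ S.erase μ, (X - C ν)) ^ 2 := by
    rw [reducedDiffPoly, hpf, hV]
    simp only [map_sub, map_mul, map_pow, mul_assoc, ← Finset.mul_sum]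
    ring
  have hc' : ∀ μ ∈ S, 0 < A * c μ := fun μ hμ => mul_pos hA0 (hc μ hμ)
  have hq : ∀ μ ∈ S, ∑ i, w i / (μ - lam i) = 0 := by
    intro μ hμ
    have h := eval_logDerivNum lam w (hSl μ hμ)
    rw [hV, eval_mul, eval_prod, Finset.prod_eq_zero hμ (by simp), mul_zero] at h
    exact (mul_eq_zero.1 h.symm).resolve_left (eval_nodePoly_ne_zero lam (hSl μ hμ))
  have hG0 : reducedDiffPoly α lam w ≠ 0 := by
    intro h
    have := coeff_reducedDiffPoly (α := α) (lam := lam) (w := w)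
    rw [h, coeff_zero] at this
    exact mul_ne_zero hA0.ne' (sub_ne_zero.2 hαA) this.symm
  have hcrit : ∀ {x}, IsRoot (reducedDiffPoly α lam w) x → IsCriticalPoint α lam w x :=
    isCriticalPoint_of_isRoot hl hw hαw
  classical
  -- Roots with q > 0 have more than k nodes below, so the truncated subtraction is exact and their
  -- labels are positive.
  let lab : ℝ → ℕ := fun x =>
    if 0 < ∑ i, w i / (x - lam i) then nodesBelow lam x - k else nodesBelow lam x
  have hlab : ∀ {x}, IsRoot (reducedDiffPoly α lam w) x →
      (0 < ∑ i, w i / (x - lam i) ∧ nodesBelow lam x = lab x + k ∧ 0 < lab x ∧ lab x + k ≤ m + 1) ∨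
      (∑ i, w i / (x - lam i) < 0 ∧ nodesBelow lam x = lab x ∧ lab x + k ≤ m) := by
    intro x hx
    rcases lt_or_gt_of_ne ((hcrit hx).sum_ne_zero hw) with h | h
    · have h1 := (hcrit hx).nodesBelow_add_le hw hα hkm hT h
      have h2 : lab x = nodesBelow lam x := if_neg h.not_gt
      exact Or.inr ⟨h, h2.symm, h2 ▸ h1⟩
    · have h1 := (hcrit hx).lt_nodesBelow hw hα hkm hT h
      have h2 : lab x = nodesBelow lam x - k := if_pos h
      have h3 := nodesBelow_le (lam := lam) x
      exact Or.inl ⟨h, by omega, by omega, by omega⟩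
  have hsep : ∀ {x y}, IsRoot (reducedDiffPoly α lam w) x → IsRoot (reducedDiffPoly α lam w) y →
      lab x = lab y → ∀ μ ∈ S, 0 < (x - μ) * (y - μ) := by
    intro x y hx hy hxy μ hμ
    have main := (hcrit hx).mul_sub_pos hl hw (hcrit hy) (hSl μ hμ) (hq μ hμ)
    rcases hlab hx with ⟨h1, h2, -⟩ | ⟨h1, h2, -⟩ <;> rcases hlab hy with ⟨h3, h4, -⟩ | ⟨h3, h4, -⟩
    · exact main (by omega) ⟨fun _ => h3, fun _ => h1⟩
    · exact absurd (by omega)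
        ((hcrit hx).nodesBelow_ne_add hl hw hα hkm hT hk (hcrit hy) h1 h3)
    · exact absurd (by omega)
        ((hcrit hy).nodesBelow_ne_add hl hw hα hkm hT hk (hcrit hx) h3 h1)
    · exact main (by omega) ⟨fun h => absurd h h1.not_gt, fun h => absurd h h3.not_gt⟩
  obtain ⟨N, hN⟩ : ∃ N, m + 1 - k = N + 1 := ⟨m - k, by omega⟩
  rw [hN]
  refine card_le_of_labels _ lab N (fun x hx => ?_) ?_ ?_ fun v _ => ?_
  · rcases hlab (isRoot_of_mem_roots hx) with h | h <;> omega
  · have hout : ∀ x, 0 = lab x → IsRoot (reducedDiffPoly α lam w) x →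
        ∀ μ ∈ S, 0 < (-1) * (x - μ) := by
      intro x hx hr μ hμ
      have := lt_root_of_nodesBelow_eq_zero hl hw (x := x) (hSl μ hμ) (hq μ hμ)
        (by rcases hlab hr with h | h <;> omega)
      linarith
    refine card_le_one_of_not_dvd hG0 _ fun x y hx hy hrx hry => ?_
    rw [hG]
    exact not_quadratic_dvd S hSne _ _ hc' x y (-1) (hout x hx hrx) (hout y hy hry)
  · have hout : ∀ x, N + 1 = lab x → IsRoot (reducedDiffPoly α lam w) x →
        ∀ μ ∈ S, 0 < 1 * (x - μ) := by
      intro x hx hr μ hμ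
      have := root_lt_of_nodesBelow_eq hl hw (x := x) (hq μ hμ)
        (by rcases hlab hr with h | h <;> omega)
      linarith
    refine card_le_one_of_not_dvd hG0 _ fun x y hx hy hrx hry => ?_
    rw [hG]
    exact not_quadratic_dvd S hSne _ _ hc' x y 1 (hout x hx hrx) (hout y hy hry)
  · refine card_le_two_of_not_dvd hG0 _ fun x y z hx hy hz hrx hry hrz => ?_
    have hxy := hsep hrx hry (hx.symm.trans hy)
    have hyz := hsep hry hrz (hy.symm.trans hz)
    have hxz := hsep hrx hrz (hx.symm.trans hz)
    rw [hG]
    exact not_cubic_dvd S hSne _ _ hc' x y z hxy hyz hxz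

end Count

/-! ### From real roots back to F_κ[p] -/

lemma nonrealZeroCount_eq_zero_of_splits {f : ℝ[X]} (hf : f.Splits) : nonrealZeroCount f = 0 := by
  have h1 := nonrealZeroCount_add_card_roots f
  have h2 := hf.natDegree_eq_card_roots
  omega

lemma C_mul_prod_ne_zero {ι : Type*} (s : Finset ι) {a : ℝ} (ha : a ≠ 0) (lam : ι → ℝ)
    (e : ι → ℕ) : C a * ∏ i ∈ s, (X - C (lam i)) ^ e i ≠ 0 :=
  mul_ne_zero (C_ne_zero.2 ha)
    (Finset.prod_ne_zero_iff.2 fun i _ => pow_ne_zero _ (X_sub_C_ne_zero (lam i)))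

lemma natDegree_C_mul_prod {ι : Type*} (s : Finset ι) {a : ℝ} (ha : a ≠ 0) (lam : ι → ℝ)
    (e : ι → ℕ) : (C a * ∏ i ∈ s, (X - C (lam i)) ^ e i).natDegree = ∑ i ∈ s, e i := by
  rw [natDegree_C_mul ha, natDegree_prod_of_monic _ _ fun i _ => (monic_X_sub_C (lam i)).pow (e i)]
  simp

/-- If any `k` of the multiplicities have a sum of at most `1 / (1 - κ)`, then `F_κ[p]` has at least
`2 k - 2` nonreal zeroes. -/
theorem le_nonrealZeroCount_diffPoly {m : ℕ} (hm : 0 < m) {κ : ℝ} {p : ℝ[X]}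
    {lam : Fin (m + 1) → ℝ} {mult : Fin (m + 1) → ℕ} (hp : HasRealZeroes p lam mult) {k : ℕ}
    (hκ : κ < 1) (hκw : ∀ i, (1 - κ) * mult i ≠ 1) (hκn : (1 - κ) * p.natDegree ≠ 1) (hk : 0 < k)
    (hkm : k ≤ m)
    (hT : ∀ T : Finset (Fin (m + 1)), T.card ≤ k → (1 - κ) * ∑ i ∈ T, (mult i : ℝ) ≤ 1) :
    2 * k - 2 ≤ nonrealZeroCount (diffPoly κ p) := by
  obtain ⟨a, ha, rfl⟩ := hp.exists_eq
  rw [natDegree_C_mul_prod _ ha, Nat.cast_sum] at hκn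
  have hw : ∀ i, (0 : ℝ) < mult i := fun i => Nat.cast_pos.2 (hp.mult_pos i)
  have hroots := card_roots_reducedDiffPoly_le hm hp.strictMono hw (sub_pos.2 hκ) hκw hκn hk hkm hT
  have hdeg := natDegree_reducedDiffPoly (lam := lam) hw hκn
  have hne : reducedDiffPoly (1 - κ) lam (fun i => (mult i : ℝ)) ≠ 0 := by
    intro h
    rw [h, natDegree_zero] at hdeg
    omega
  rw [diffPoly_eq_mul lam κ a mult hp.mult_pos,
    nonrealZeroCount_mul (pow_ne_zero 2 (C_mul_prod_ne_zero _ ha _ _)) hne]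
  have := nonrealZeroCount_add_card_roots (reducedDiffPoly (1 - κ) lam fun i => (mult i : ℝ))
  omega

/-! ### A polynomial whose F_κ has only real zeroes -/

lemma coeff_diffPoly {κ : ℝ} {p : ℝ[X]} {e : ℕ} (hp : p.natDegree = e + 2) :
    (diffPoly κ p).coeff (2 * e + 2) =
      p.leadingCoeff ^ 2 * (e + 2) * ((1 - κ) * (e + 2) - 1) := by
  have h1 : (derivative p).natDegree ≤ e + 1 := (natDegree_derivative_le p).trans (by omega)
  have h2 : (derivative (derivative p)).natDegree ≤ e := (natDegree_derivative_le _).trans (by omega)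
  have h3 : p.coeff (e + 2) = p.leadingCoeff := by rw [leadingCoeff, hp]
  have h4 := coeff_mul_add_eq_of_natDegree_le hp.le h2
  have h5 := coeff_pow_of_natDegree_le (m := 2) h1
  simp only [coeff_derivative, h3, add_assoc, one_add_one_eq_two] at h4 h5
  have e1 : e + (2 + e) = 2 * e + 2 := by ring
  have e2 : 2 * (e + 1) = 2 * e + 2 := by ring
  rw [e1] at h4
  rw [e2] at h5
  rw [diffPoly, coeff_sub, coeff_C_mul, h4, h5]
  push_cast
  ring

lemma exists_gt_eval_diffPoly_pos {κ : ℝ} {p : ℝ[X]} (hp : 2 ≤ p.natDegree)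
    (hκ : 1 < (1 - κ) * p.natDegree) (b : ℝ) : ∃ x, b < x ∧ 0 < (diffPoly κ p).eval x := by
  obtain ⟨e, he⟩ : ∃ e, p.natDegree = e + 2 := ⟨p.natDegree - 2, by omega⟩
  have hp0 : p.leadingCoeff ≠ 0 := by
    rw [Ne, leadingCoeff_eq_zero]; rintro rfl; simp at hp
  rw [he] at hκ
  push_cast at hκ
  have hc : 0 < (diffPoly κ p).coeff (2 * e + 2) := by
    rw [coeff_diffPoly he]
    have : 0 < (1 - κ) * ((e : ℝ) + 2) - 1 := sub_pos.2 hκ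
    positivity
  have hdeg : (diffPoly κ p).natDegree = 2 * e + 2 :=
    le_antisymm ((natDegree_diffPoly_le κ p).trans (by omega)) (le_natDegree_of_ne_zero hc.ne')
  have ht : Filter.Tendsto (fun x => (diffPoly κ p).eval x) Filter.atTop Filter.atTop := by
    refine tendsto_atTop_of_leadingCoeff_nonneg _ (natDegree_pos_iff_degree_pos.1 (by omega)) ?_
    rw [leadingCoeff, hdeg]
    exact hc.le
  exact ((Filter.eventually_gt_atTop b).and (ht.eventually_gt_atTop 0)).exists

lemma diffPoly_comp_neg_X (κ : ℝ) (p : ℝ[X]) :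
    diffPoly κ (p.comp (-X)) = (diffPoly κ p).comp (-X) := by
  simp [diffPoly, derivative_comp]

lemma exists_lt_eval_diffPoly_pos {κ : ℝ} {p : ℝ[X]} (hp : 2 ≤ p.natDegree)
    (hκ : 1 < (1 - κ) * p.natDegree) (b : ℝ) : ∃ x, x < b ∧ 0 < (diffPoly κ p).eval x := by
  have hdeg : (p.comp (-X)).natDegree = p.natDegree := by rw [natDegree_comp]; simp
  obtain ⟨x, hx, h⟩ := exists_gt_eval_diffPoly_pos (κ := κ) (p := p.comp (-X))
    (by rwa [hdeg]) (by rwa [hdeg]) (-b)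
  rw [diffPoly_comp_neg_X, eval_comp, eval_neg, eval_X] at h
  exact ⟨-x, by linarith, h⟩

/-- Positivity of `F_κ[p]` at a point survives a new zero of `p` far to the right. -/
lemma eventually_eval_diffPoly_mul_pos {κ : ℝ} {p : ℝ[X]} {x : ℝ}
    (hx : 0 < (diffPoly κ p).eval x) :
    ∀ᶠ T in Filter.atTop, 0 < (diffPoly κ (p * (X - C T))).eval x := by
  set A := (diffPoly κ p).eval x with hA
  set B := 2 * (1 - κ) * p.eval x * (derivative p).eval x with hB
  set D := κ * p.eval x ^ 2 with hD
  have hev : ∀ T, (diffPoly κ (p * (X - C T))).eval x = A * (T - x) ^ 2 - B * (T - x) - D := by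
    intro T
    simp only [hA, hB, hD, diffPoly, derivative_mul, derivative_add, derivative_sub, derivative_X,
      derivative_C, sub_zero, mul_one, eval_sub, eval_add,
      eval_mul, eval_pow, eval_C, eval_X]
    ring
  filter_upwards [Filter.eventually_gt_atTop (x + 1 + (|B| + |D|) / A)] with T hT
  rw [hev]
  have h0 : 0 ≤ (|B| + |D|) / A := by positivity
  have h1 : 1 < T - x := by linarith
  have h2 : (|B| + |D|) / A < T - x := by linarith
  rw [div_lt_iff₀ hx] at h2
  have h3 : 0 < (T - x) * ((T - x) * A - (|B| + |D|)) :=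
    mul_pos (by linarith) (by linarith)
  have h4 : B * (T - x) ≤ |B| * (T - x) := mul_le_mul_of_nonneg_right (le_abs_self B) (by linarith)
  have h5 : D ≤ |D| * (T - x) := (le_abs_self D).trans (le_mul_of_one_le_right (abs_nonneg D) h1.le)
  linarith

lemma eval_diffPoly_simple_root_neg {κ : ℝ} (hκ : 0 < κ) {h : ℝ[X]} {a : ℝ} (ha : h.eval a ≠ 0) :
    (diffPoly κ ((X - C a) * h)).eval a < 0 := by
  have : (diffPoly κ ((X - C a) * h)).eval a = -(κ * h.eval a ^ 2) := by
    simp [diffPoly]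
  rw [this, neg_lt_zero]
  positivity

/-- The polynomial with a zero of multiplicity `M + 1` at the origin and the simple zeroes
`lam 0, …, lam (m - 1)`. -/
noncomputable def oneMultiplePoly (M m : ℕ) (lam : ℕ → ℝ) : ℝ[X] :=
  X ^ (M + 1) * ∏ i ∈ Finset.range m, (X - C (lam i))

lemma natDegree_oneMultiplePoly (M m : ℕ) (lam : ℕ → ℝ) :
    (oneMultiplePoly M m lam).natDegree = M + 1 + m := by
  rw [oneMultiplePoly, (monic_X_pow _).natDegree_mul
    (monic_prod_of_monic _ _ fun _ _ => monic_X_sub_C _), natDegree_X_pow,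
    natDegree_prod_of_monic _ _ fun _ _ => monic_X_sub_C _]
  simp

lemma one_lt_mul_natDegree {κ : ℝ} {M : ℕ} (hκ : 1 < (1 - κ) * (M + 2)) (m : ℕ) (lam : ℕ → ℝ) :
    1 < (1 - κ) * (oneMultiplePoly M (m + 1) lam).natDegree := by
  rw [natDegree_oneMultiplePoly]
  push_cast
  have h1 : 0 < 1 - κ := pos_of_mul_pos_left (zero_lt_one.trans hκ) (by positivity)
  have h2 : 0 ≤ (1 - κ) * m := by positivity
  linarith

/-- Simple zeroes can be chosen so that `F_κ` is positive somewhere between any two of them, and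
outside of them. -/
lemma exists_interlacing {κ : ℝ} {M : ℕ} (hκ : 1 < (1 - κ) * (M + 2)) (m : ℕ) :
    ∃ lam x : ℕ → ℝ, 0 < lam 0 ∧ (∀ i ≤ m, x i < lam i ∧ lam i < x (i + 1)) ∧
      ∀ i ≤ m + 1, 0 < (diffPoly κ (oneMultiplePoly M (m + 1) lam)).eval (x i) := by
  induction m with
  | zero =>
    have h2 : 2 ≤ (oneMultiplePoly M (0 + 1) fun _ => 1).natDegree := by
      rw [natDegree_oneMultiplePoly]; omega
    obtain ⟨y, hy, hFy⟩ := exists_gt_eval_diffPoly_pos h2 (one_lt_mul_natDegree hκ 0 fun _ => 1) 1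
    obtain ⟨z, hz, hFz⟩ := exists_lt_eval_diffPoly_pos h2 (one_lt_mul_natDegree hκ 0 fun _ => 1) 1
    refine ⟨fun _ => 1, fun i => if i = 0 then z else y, one_pos, fun i hi => ?_, fun i hi => ?_⟩
    · obtain rfl : i = 0 := by omega
      simpa using ⟨hz, hy⟩
    · by_cases h : i = 0
      · simpa [h] using hFz
      · simpa [h] using hFy
  | succ m ih =>
    obtain ⟨lam, x, h0, hlt, hF⟩ := ih
    -- Only finitely many test points must stay positive, so one large T serves them all.
    have hev : ∀ᶠ T in Filter.atTop, ∀ i ∈ Finset.range (m + 2),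
        0 < (diffPoly κ (oneMultiplePoly M (m + 1) lam * (X - C T))).eval (x i) := by
      rw [Filter.eventually_all_finset]
      intro i hi
      exact eventually_eval_diffPoly_mul_pos (hF i (by have := Finset.mem_range.1 hi; omega))
    obtain ⟨T, hT, hxT⟩ := (hev.and (Filter.eventually_gt_atTop (x (m + 1)))).exists
    have hpoly : oneMultiplePoly M (m + 1 + 1) (Function.update lam (m + 1) T) =
        oneMultiplePoly M (m + 1) lam * (X - C T) := by
      rw [oneMultiplePoly, oneMultiplePoly, Finset.prod_range_succ, Function.update_self, mul_assoc]
      congr 2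
      refine Finset.prod_congr rfl fun i hi => ?_
      rw [Function.update_of_ne (Finset.mem_range.1 hi).ne]
    have h2 : 2 ≤ (oneMultiplePoly M (m + 1 + 1) (Function.update lam (m + 1) T)).natDegree := by
      rw [natDegree_oneMultiplePoly]; omega
    obtain ⟨y, hy, hFy⟩ := exists_gt_eval_diffPoly_pos h2
      (one_lt_mul_natDegree hκ (m + 1) (Function.update lam (m + 1) T)) T
    refine ⟨Function.update lam (m + 1) T, Function.update x (m + 2) y, ?_, fun i hi => ?_,
      fun i hi => ?_⟩
    · rwa [Function.update_of_ne (Nat.succ_ne_zero m).symm]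
    · rcases Nat.lt_or_eq_of_le hi with h | rfl
      · rw [Function.update_of_ne (by omega), Function.update_of_ne (by omega),
          Function.update_of_ne (by omega)]
        exact hlt i (by omega)
      · rw [Function.update_of_ne (by omega), Function.update_self, Function.update_self]
        exact ⟨hxT, hy⟩
    · rcases Nat.lt_or_eq_of_le hi with h | rfl
      · rw [Function.update_of_ne (by omega), hpoly]
        exact hT i (Finset.mem_range.2 (by omega))
      · rw [Function.update_self]
        exact hFy

lemma le_card_roots_of_sign_changes {f : ℝ[X]} (hf : f ≠ 0) (N : ℕ) (t : ℕ → ℝ)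
    (ht : ∀ i < N, t i < t (i + 1)) (hs : ∀ i < N, f.eval (t i) * f.eval (t (i + 1)) < 0) :
    N ≤ f.roots.card := by
  have hroot : ∀ i : Fin N, ∃ r, t i < r ∧ r < t (i + 1) ∧ f.eval r = 0 := by
    intro i
    have hcont := f.continuousOn (s := Set.Icc (t i) (t (i + 1)))
    rcases mul_neg_iff.1 (hs i i.2) with ⟨h1, h2⟩ | ⟨h1, h2⟩
    · obtain ⟨r, hr, h⟩ := intermediate_value_Ioo' (ht i i.2).le hcont ⟨h2, h1⟩
      exact ⟨r, hr.1, hr.2, h⟩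
    · obtain ⟨r, hr, h⟩ := intermediate_value_Ioo (ht i i.2).le hcont ⟨h1, h2⟩
      exact ⟨r, hr.1, hr.2, h⟩
  choose r h1 h2 h3 using hroot
  have hmono : ∀ i j : ℕ, i ≤ j → j ≤ N → t i ≤ t j := by
    intro i j hij
    induction j, hij using Nat.le_induction with
    | base => exact fun _ => le_rfl
    | succ j _ ih => exact fun h => (ih (by omega)).trans (ht j (by omega)).le
  have hr : StrictMono r := fun i j hij =>
    ((h2 i).trans_le (hmono (i + 1) j hij j.2.le)).trans (h1 j)
  calc N = (Finset.univ.image r).card := by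
        rw [Finset.card_image_of_injective _ hr.injective, Finset.card_fin]
    _ ≤ f.roots.toFinset.card := by
        refine Finset.card_le_card fun y hy => ?_
        obtain ⟨j, -, rfl⟩ := Finset.mem_image.1 hy
        rw [Multiset.mem_toFinset, mem_roots hf]
        exact h3 j
    _ ≤ f.roots.card := Multiset.toFinset_card_le _

/-- At a zero of order M + 1 both p p'' and (p')² vanish to order at least 2M. -/
lemma X_pow_dvd_diffPoly (κ : ℝ) (M : ℕ) (r : ℝ[X]) :
    X ^ (2 * M) ∣ diffPoly κ (X ^ (M + 1) * r) := by
  set s := C ((M : ℝ) + 1) * r + X * derivative r with hs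
  have h1 : derivative (X ^ (M + 1) * r) = X ^ M * s := by
    rw [derivative_mul, derivative_X_pow, hs]
    simp
    ring
  have h2 : X * derivative (X ^ M * s) = X ^ M * (C (M : ℝ) * s + X * derivative s) := by
    rw [derivative_mul, derivative_X_pow]
    rcases M with _ | M
    · simp
    · rw [Nat.add_sub_cancel]
      ring
  refine ⟨r * (C (M : ℝ) * s + X * derivative s) - C κ * s ^ 2, ?_⟩
  rw [diffPoly, h1]
  linear_combination X ^ M * r * h2

/-- For `κ` below the threshold there are simple zeroes for which `F_κ` has only real zeroes. -/
lemma exists_nonrealZeroCount_eq_zero {κ : ℝ} (hκ0 : 0 < κ) {M : ℕ} (hκ : 1 < (1 - κ) * (M + 2))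
    (m : ℕ) : ∃ lam : ℕ → ℝ, 0 < lam 0 ∧ (∀ i < m, lam i < lam (i + 1)) ∧
      nonrealZeroCount (diffPoly κ (oneMultiplePoly M (m + 1) lam)) = 0 := by
  obtain ⟨lam, x, h0, hlt, hF⟩ := exists_interlacing hκ m
  have hmono : ∀ i < m, lam i < lam (i + 1) := fun i hi =>
    (hlt i hi.le).2.trans (hlt (i + 1) hi).1
  refine ⟨lam, h0, hmono, ?_⟩
  have hle : ∀ i j, i ≤ j → j ≤ m → lam i ≤ lam j := by
    intro i j hij
    induction j, hij using Nat.le_induction with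
    | base => exact fun _ => le_rfl
    | succ j _ ih => exact fun h => (ih (by omega)).trans (hmono j (by omega)).le
  have hlm : ∀ i j, i < j → j ≤ m → lam i < lam j := fun i j hij hj =>
    (hmono i (by omega)).trans_le (hle (i + 1) j hij hj)
  have hneg : ∀ i ≤ m, (diffPoly κ (oneMultiplePoly M (m + 1) lam)).eval (lam i) < 0 := by
    intro i hi
    have himem : i ∈ Finset.range (m + 1) := Finset.mem_range.2 (by omega)
    rw [oneMultiplePoly, ← Finset.mul_prod_erase _ _ himem, mul_left_comm]
    refine eval_diffPoly_simple_root_neg hκ0 ?_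
    rw [eval_mul, eval_pow, eval_X, eval_prod]
    refine mul_ne_zero (pow_ne_zero _ (h0.trans_le (hle 0 i (Nat.zero_le i) hi)).ne')
      (Finset.prod_ne_zero_iff.2 fun j hj => ?_)
    rw [eval_sub, eval_X, eval_C, sub_ne_zero]
    have hj1 := Finset.ne_of_mem_erase hj
    have hj2 := Finset.mem_range.1 (Finset.mem_of_mem_erase hj)
    rcases lt_or_gt_of_ne hj1 with h | h
    · exact (hlm j i h hi).ne'
    · exact (hlm i j h (by omega)).ne
  obtain ⟨G, hG⟩ := X_pow_dvd_diffPoly κ M (∏ i ∈ Finset.range (m + 1), (X - C (lam i)))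
  change diffPoly κ (oneMultiplePoly M (m + 1) lam) = _ at hG
  have hne : diffPoly κ (oneMultiplePoly M (m + 1) lam) ≠ 0 := by
    intro h
    have := hF 0 (Nat.zero_le _)
    rw [h, eval_zero] at this
    exact this.false
  have hG0 : G ≠ 0 := by rintro rfl; exact hne (by rw [hG, mul_zero])
  have hev : ∀ y, (diffPoly κ (oneMultiplePoly M (m + 1) lam)).eval y = y ^ (2 * M) * G.eval y := by
    intro y; rw [hG, eval_mul, eval_pow, eval_X]
  have hGpos : ∀ i ≤ m + 1, 0 < G.eval (x i) := fun i hi =>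
    pos_of_mul_pos_right (hev (x i) ▸ hF i hi) (by rw [pow_mul]; positivity)
  have hGneg : ∀ i ≤ m, G.eval (lam i) < 0 := fun i hi =>
    neg_of_mul_neg_right (hev (lam i) ▸ hneg i hi) (by rw [pow_mul]; positivity)
  have hdeg : G.natDegree ≤ 2 * (m + 1) := by
    have h1 := natDegree_diffPoly_le κ (oneMultiplePoly M (m + 1) lam)
    rw [natDegree_oneMultiplePoly, hG, natDegree_mul (pow_ne_zero _ X_ne_zero) hG0,
      natDegree_X_pow] at h1
    omega
  have hcard : 2 * (m + 1) ≤ G.roots.card := by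
    refine le_card_roots_of_sign_changes hG0 _
      -- The chain x 0 < lam 0 < x 1 < … < lam m < x (m + 1) has 2(m + 1) sign changes, as many as
      -- the degree of G allows.
      (fun j => if Even j then x (j / 2) else lam (j / 2)) (fun j hj => ?_) fun j hj => ?_
    · rcases Nat.even_or_odd' j with ⟨i, rfl | rfl⟩
      · have : (2 * i + 1) / 2 = i := by omega
        simpa [this] using (hlt i (by omega)).1
      · have h1 : (2 * i + 1) / 2 = i := by omega
        have h2 : (2 * i + 1 + 1) / 2 = i + 1 := by omega
        have h3 : Even (2 * i + 1 + 1) := ⟨i + 1, by ring⟩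
        simpa [h1, h2, h3] using (hlt i (by omega)).2
    · rcases Nat.even_or_odd' j with ⟨i, rfl | rfl⟩
      · have : (2 * i + 1) / 2 = i := by omega
        simpa [this] using mul_neg_of_pos_of_neg (hGpos i (by omega)) (hGneg i (by omega))
      · have h1 : (2 * i + 1) / 2 = i := by omega
        have h2 : (2 * i + 1 + 1) / 2 = i + 1 := by omega
        have h3 : Even (2 * i + 1 + 1) := ⟨i + 1, by ring⟩
        simpa [h1, h2, h3] using
          mul_neg_of_neg_of_pos (hGneg i (by omega)) (hGpos (i + 1) (by omega))
  rw [hG, nonrealZeroCount_mul (pow_ne_zero _ X_ne_zero) hG0,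
    nonrealZeroCount_eq_zero_of_splits (Splits.X_pow _)]
  have := nonrealZeroCount_add_card_roots G
  omega

/-! ### Multiplicity bookkeeping and the theorem -/

lemma HasRealZeroes.natDegree_eq {d : ℕ} {p : ℝ[X]} {lam : Fin d → ℝ} {mult : Fin d → ℕ}
    (hp : HasRealZeroes p lam mult) : p.natDegree = ∑ i, mult i := by
  obtain ⟨a, ha, rfl⟩ := hp.exists_eq
  exact natDegree_C_mul_prod _ ha _ _

/-- The multiplicities of few zeroes leave room for the remaining distinct zeroes. -/
lemma HasRealZeroes.sum_add_le {d : ℕ} {p : ℝ[X]} {lam : Fin d → ℝ} {mult : Fin d → ℕ}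
    (hp : HasRealZeroes p lam mult) (T : Finset (Fin d)) :
    ∑ i ∈ T, mult i + d ≤ p.natDegree + T.card := by
  have h1 : Tᶜ.card ≤ ∑ i ∈ Tᶜ, mult i := by
    rw [Finset.card_eq_sum_ones]
    exact Finset.sum_le_sum fun i _ => hp.mult_pos i
  have h2 := Finset.sum_add_sum_compl T mult
  have h3 := Finset.card_add_card_compl T
  rw [Fintype.card_fin] at h3
  rw [hp.natDegree_eq]
  omega

theorem theorem4p15 (n d : ℕ) (hd : 3 ≤ d) (hdn : d ≤ n) (κ : ℝ) :
    -- lower bound for every real-rooted `p` of degree `n` with exactly `d` distinct zeroes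
    (∀ k : ℕ, 2 ≤ k → k ≤ d - 1 →
      ((n : ℝ) - d + k - 1) / ((n : ℝ) - d + k) ≤ κ →
      κ < ((n : ℝ) - d + k) / ((n : ℝ) - d + k + 1) →
      ∀ (p : Polynomial ℝ) (lam : Fin d → ℝ) (mult : Fin d → ℕ),
        HasRealZeroes p lam mult → p.natDegree = n →
          2 * k - 2 ≤ nonrealZeroCount (diffPoly κ p)) ∧
    -- below the first threshold all zeroes of `F_κ[p]` can be real
    (0 < κ → κ < ((n : ℝ) - d + 1) / ((n : ℝ) - d + 2) →
      ∃ (p : Polynomial ℝ) (lam : Fin d → ℝ) (mult : Fin d → ℕ),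
        HasRealZeroes p lam mult ∧ p.natDegree = n ∧
          ((minInteriorMult mult : ℝ) - 1) / (minInteriorMult mult : ℝ) < κ ∧
          nonrealZeroCount (diffPoly κ p) = 0) := by
  obtain ⟨M, rfl⟩ : ∃ M, n = M + d := ⟨n - d, by omega⟩
  have hMd : ((M + d : ℕ) : ℝ) - d = M := by push_cast; ring
  rw [hMd]
  have hM0 : (0 : ℝ) ≤ M := Nat.cast_nonneg M
  constructor
  · intro k hk hkd hκ1 hκ2 p lam mult hp hn
    obtain ⟨m, rfl⟩ : ∃ m, d = m + 1 := ⟨d - 1, by omega⟩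
    have hk' : (2 : ℝ) ≤ k := by exact_mod_cast hk
    rw [div_le_iff₀ (by linarith)] at hκ1
    rw [lt_div_iff₀ (by linarith)] at hκ2
    have hκ : κ < 1 := by
      by_contra! h
      have : (M : ℝ) + k + 1 ≤ κ * (M + k + 1) := le_mul_of_one_le_left (by linarith) h
      linarith
    -- With M = n - d, the hypotheses on κ read (1 - κ)(M + k) ≤ 1 < (1 - κ)(M + k + 1). This bound
    -- settles sums of k multiplicities and, as k ≥ 2, makes each single one strict; k ≤ d - 1 gives
    -- (1 - κ)n > 1.
    have hsum : ∀ T : Finset (Fin (m + 1)), ∑ i ∈ T, (mult i : ℝ) ≤ M + T.card := by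
      intro T
      have := hp.sum_add_le T
      rw [hn] at this
      have h : ∑ i ∈ T, mult i ≤ M + T.card := by omega
      exact_mod_cast h
    refine le_nonrealZeroCount_diffPoly (by omega) hp hκ (fun i => ?_) ?_ (by omega) (by omega)
      fun T hT => ?_
    · have h1 := hsum {i}
      simp only [Finset.sum_singleton, Finset.card_singleton, Nat.cast_one] at h1
      have h2 : (1 - κ) * mult i < (1 - κ) * (M + k) :=
        mul_lt_mul_of_pos_left (by linarith) (sub_pos.2 hκ)
      exact ne_of_lt (by linarith)
    · have h1 : (M : ℝ) + k + 1 ≤ (M + (m + 1) : ℕ) := by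
        have : M + k + 1 ≤ M + (m + 1) := by omega
        exact_mod_cast this
      have h2 := mul_le_mul_of_nonneg_left h1 (sub_pos.2 hκ).le
      rw [hn]
      exact ne_of_gt (by linarith)
    · have h1 : (T.card : ℝ) ≤ k := by exact_mod_cast hT
      have h2 := mul_le_mul_of_nonneg_left ((hsum T).trans (add_le_add_right h1 _))
        (sub_pos.2 hκ).le
      linarith
  · intro hκ0 hκ
    rw [lt_div_iff₀ (by linarith)] at hκ
    obtain ⟨m, rfl⟩ : ∃ m, d = m + 1 + 1 := ⟨d - 2, by omega⟩
    obtain ⟨lam, h0, hmono, hreal⟩ :=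
      exists_nonrealZeroCount_eq_zero (κ := κ) (M := M) hκ0 (by linarith) m
    -- The multiple zero is the smallest one, so all interior zeroes are simple, and d ≥ 3 ensures
    -- there is one; thus (m₁ - 1)/m₁ = 0 < κ.
    have hmult : minInteriorMult (Fin.cons (M + 1) fun _ => 1 : Fin (m + 1 + 1) → ℕ) = 1 := by
      have : (Fin.cons (M + 1) fun _ => 1 : Fin (m + 1 + 1) → ℕ) ''
          {k | 0 < (k : ℕ) ∧ (k : ℕ) + 1 < m + 1 + 1} = {1} := by
        refine Set.Subset.antisymm ?_ (Set.singleton_subset_iff.2 ?_)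
        · rintro _ ⟨k, hk, rfl⟩
          obtain ⟨j, rfl⟩ := Fin.exists_succ_eq.2 (Fin.pos_iff_ne_zero.1 hk.1)
          simp
        · exact ⟨Fin.succ 0, ⟨by simp, by simp; omega⟩, by rw [Fin.cons_succ]⟩
      rw [minInteriorMult, this, csInf_singleton]
    refine ⟨oneMultiplePoly M (m + 1) lam, Fin.cons 0 fun i => lam i, Fin.cons (M + 1) fun _ => 1,
      ⟨?_, ?_, 1, one_ne_zero, ?_⟩, ?_, ?_, hreal⟩
    · rw [Fin.strictMono_iff_lt_succ]
      intro i
      refine Fin.cases ?_ (fun j => ?_) i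
      · simpa using h0
      · rw [Fin.cons_succ, ← Fin.succ_castSucc, Fin.cons_succ]
        simpa using hmono j j.2
    · intro i
      refine Fin.cases (by simp) (fun j => by simp) i
    · rw [Fin.prod_univ_succ, oneMultiplePoly, Finset.prod_range]
      simp
    · rw [natDegree_oneMultiplePoly]; omega
    · rw [hmult]; simpa using hκ0
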